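/- For a field $K$ of characteristic $2$ and $m\ge 0$ let $\Omega^m_K$ be the space of absolute $m$-differential forms ($\Omega^m_K=0$ for $m<0$) and let $$H_2^{m+1}(K)=\Omega_K^m/\bigl(d\Omega_K^{m-1}+\wp(\Omega_K^m)\bigr)$$ be the Kato–Milne cohomology group, where $\wp(\Omega^m_K)$ denotes the subgroup generated by the forms $(a^2-a)\frac{dx_1}{x_1}\wedge\dots\wedge\frac{dx_m}{x_m}$ with $a\in K$, $x_i\in K^*$; a homomorphism of fields $K\to L$ induces a homomorphism $H_2^{m+1}(K)\to H_2^{m+1}(L)$. A 2-basis of $K$ is a family $(t_i)_i$ such that the products $\prod_i t_i^{\epsilon_i}$ ($\epsilon_i\in\{0,1\}$, almost all $0$) form a basis of $K$ over $K^2$. Let $F$ be a field of characteristic $2$ which is complete with respect to a discrete valuation, with valuation ring $A_F$, residue field $\bar F$ and a uniformizer $\pi$. Let $(\bar b_i)_{i\in\mathcal I'}$ be a 2-basis of $\bar F$ indexed by a totally ordered set $\mathcal I'$, and let $t=(t_i)_{i\in\mathcal I'}$ in $A_F$ be a lifting of it (that is, $t_i$ has residue class $\bar b_i$ for each $i$).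 Let $\alpha_t:\bar F\to A_F\subset F$ be the associated Teichmüller lifting, i.e. the ring homomorphism that is a section of the residue map and satisfies $\alpha_t(\bar b_i)=t_i$ for all $i$. Let $\alpha_t':H_2^{m+1}(\bar F)\to H_2^{m+1}(F)$ be the induced map, and put $$W_1(H_2^{m+1}(F))_t=\operatorname{coker}(\alpha'_t).$$ Put $\mathcal I=\mathcal I'\cup\{\infty\}$ with $i<\infty$ for all $i\in\mathcal I'$, $t_\infty=\pi$, $T=\bigoplus_{i\in\mathcal I}\mathbb Z/2\mathbb Z$ with the order in which $I<J$ if there is $k\in\mathcal I$ with $I_k=0$, $J_k=1$ and $I_i=J_i$ for all $i>k$, $t^J=\prod_i t_i^{J_i}$, and $R_t=\alpha_t(\bar F)[\pi^{-1}]$. Let $\mathcal R_t\subset H_2^{m+1}(F)$ be the subgroup generated by the classes of the forms $$t^J r^2\,\frac{dt_{i_1}}{t_{i_1}}\wedge\dots\wedge\frac{dt_{i_m}}{t_{i_m}},\qquad r\in\pi^{-1}R_t,\quad I,J\in T,\quad J+I>I,$$ where $i_1<\dots<i_m$ are the indices of the nonzero components of $I$, of which there are exactly $m$. Let $t$ and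 $t'$ be two liftings of the same 2-basis $(\bar b_i)_{i\in\mathcal I'}$ of $\bar F$, with the same $\pi$, and let $m\ge0$. Then: 1. $W_1(H_2^{m+1}(F))$ does not depend on the lifting: there is an isomorphism $W_1(H_2^{m+1}(F))_t\cong W_1(H_2^{m+1}(F))_{t'}$ compatible with the projections from $H_2^{m+1}(F)$. 2. The projection from $H_2^{m+1}(F)$ is injective on $\mathcal R_t$ and on $\mathcal R_{t'}$, so that these are subgroups of $W_1(H_2^{m+1}(F))_t$ and $W_1(H_2^{m+1}(F))_{t'}$. As such, $\mathcal R$ is unique up to isomorphism: there is a group isomorphism $W_1(H_2^{m+1}(F))_t\to W_1(H_2^{m+1}(F))_{t'}$ that maps $\mathcal R_t$ onto $\mathcal R_{t'}$. -/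

import Mathlib

open scoped Valued WithZero symmDiff

noncomputable section

namespace KatoMilne

section Forms

variable (K : Type*) [Field K]

/-- The space `Ω^m_K` of absolute `m`-differential forms: the `m`-th exterior power over `K` of the
space of Kähler differentials. -/
abbrev Form (m : ℕ) : Type _ := ⋀[K]^m (Ω[K⁄ℤ])

variable {K}

/-- The logarithmic differential `dx / x`. -/
def dlog (x : K) : Ω[K⁄ℤ] := x⁻¹ • KaehlerDifferential.D ℤ K x

/-- The form `a dx₁/x₁ ∧ … ∧ dxₘ/xₘ`. -/
def logForm {m : ℕ} (a : K) (x : Fin m → K) : Form K m :=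
  a • exteriorPower.ιMulti K m (fun i => dlog (x i))

variable (K)

/-- The group `dΩ^{m-1}_K` of exact `m`-forms. The group `Ω^m` is additively generated by the forms
`a₀ da₁ ∧ … ∧ daₘ`, whose differentials are `da₀ ∧ da₁ ∧ … ∧ daₘ`; in degree `0` there is no
nonzero exact form, since `Ω^{-1} = 0`. -/
def exactForms : (m : ℕ) → AddSubgroup (Form K m)
  | 0 => ⊥
  | m + 1 => AddSubgroup.closure
      (Set.range fun a : Fin (m + 1) → K =>
        exteriorPower.ιMulti K (m + 1) (fun i => KaehlerDifferential.D ℤ K (a i)))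

/-- The group of representatives of the image of the Artin-Schreier operator `Φ - Id`. In
characteristic two the Frobenius homomorphism `Φ : Ω^m → Ω^m / dΩ^{m-1}` is the additive map with
`Φ (a dx₁/x₁ ∧ … ∧ dxₘ/xₘ) = a² dx₁/x₁ ∧ … ∧ dxₘ/xₘ` for all `a` and all nonzero `xᵢ`. -/
def artinSchreierForms (m : ℕ) : AddSubgroup (Form K m) :=
  AddSubgroup.closure
    {ω | ∃ (a : K) (x : Fin m → K), (∀ i, x i ≠ 0) ∧ ω = logForm (a ^ 2 - a) x}

/-- The Kato-Milne cohomology group: for a field `K` of characteristic two, `H K m` is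
`H₂^{m+1}(K) = Ω^m / (dΩ^{m-1} + (Φ - Id) Ω^m)`. -/
abbrev H (m : ℕ) : Type _ := Form K m ⧸ (exactForms K m ⊔ artinSchreierForms K m)

variable {K}

/-- The class in `H₂^{m+1}(K)` of the form `a dx₁/x₁ ∧ … ∧ dxₘ/xₘ`. -/
def symbol {m : ℕ} (a : K) (x : Fin m → K) : H K m := QuotientAddGroup.mk (logForm a x)

end Forms

section Functoriality

variable {K L : Type*} [Field K] [Field L]

/-- The map `Ω^m_K → Ω^m_L` induced by a field homomorphism `K → L`. -/
def formMap (α : K →+* L) (m : ℕ) : Form K m →+ Form L m :=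
  letI := α.toAlgebra
  (exteriorPower.alternatingMapLinearEquiv
    ({ ((exteriorPower.ιMulti L m).toMultilinearMap.restrictScalars K).compLinearMap
          (fun _ : Fin m => KaehlerDifferential.map ℤ ℤ K L) with
        map_eq_zero_of_eq' := fun _ _ _ h hij =>
          (exteriorPower.ιMulti L m).map_eq_zero_of_eq _
            (congrArg (KaehlerDifferential.map ℤ ℤ K L) h) hij } :
      (Ω[K⁄ℤ]) [⋀^Fin m]→ₗ[K] (Form L m))).toAddMonoidHom

theorem formMap_smul_D (α : K →+* L) {m : ℕ} (a : K) (c x : Fin m → K) :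
    formMap α m (a • exteriorPower.ιMulti K m
        (fun i => c i • KaehlerDifferential.D ℤ K (x i))) =
      α a • exteriorPower.ιMulti L m
        (fun i => α (c i) • KaehlerDifferential.D ℤ L (α (x i))) := by
  let _ := α.toAlgebra
  unfold formMap
  rw [LinearMap.toAddMonoidHom_coe, map_smul,
    exteriorPower.alternatingMapLinearEquiv_apply_ιMulti, algebra_compatible_smul L a]
  congr 1
  change exteriorPower.ιMulti L m (fun i => KaehlerDifferential.map ℤ ℤ K L _) = _
  congr 1
  funext i
  rw [map_smul, KaehlerDifferential.map_D, algebra_compatible_smul L (c i)]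
  rfl

theorem formMap_logForm (α : K →+* L) {m : ℕ} (a : K) (x : Fin m → K) :
    formMap α m (logForm a x) = logForm (α a) (fun i => α (x i)) := by
  unfold logForm dlog
  rw [formMap_smul_D]
  simp only [map_inv₀]

theorem formMap_mem (α : K →+* L) (m : ℕ) :
    exactForms K m ⊔ artinSchreierForms K m ≤
      (exactForms L m ⊔ artinSchreierForms L m).comap (formMap α m) := by
  refine sup_le ?_ ?_
  · cases m with
    | zero => exact bot_le
    | succ m =>
      refine (AddSubgroup.closure_le _).2 ?_
      rintro _ ⟨a, rfl⟩
      refine AddSubgroup.mem_sup_left (AddSubgroup.subset_closure ⟨fun i => α (a i), ?_⟩)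
      have h := formMap_smul_D α 1 (fun _ => 1) a
      simp only [map_one, one_smul] at h
      exact h.symm
  · refine (AddSubgroup.closure_le _).2 ?_
    rintro _ ⟨a, x, hx, rfl⟩
    refine AddSubgroup.mem_sup_right (AddSubgroup.subset_closure
      ⟨α a, fun i => α (x i), fun i => (map_ne_zero α).2 (hx i), ?_⟩)
    rw [formMap_logForm, map_sub, map_pow]

/-- The map `H₂^{m+1}(K) → H₂^{m+1}(L)` induced by a field homomorphism `K → L`. -/
def cohomMap (α : K →+* L) (m : ℕ) : H K m →+ H L m :=
  QuotientAddGroup.map _ _ (formMap α m) (formMap_mem α m)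

theorem cohomMap_symbol (α : K →+* L) {m : ℕ} (a : K) (x : Fin m → K) :
    cohomMap α m (symbol a x) = symbol (α a) (fun i => α (x i)) :=
  congrArg QuotientAddGroup.mk (formMap_logForm α a x)

end Functoriality

/-- A family `(tᵢ)` is a 2-basis of a field `K` of characteristic two if the products
`∏ tᵢ^{εᵢ}`, with `εᵢ ∈ {0, 1}` almost all zero, form a basis of `K` over its subfield `K²` of
squares. The exponent vectors `ε` are given by their supports. -/
def IsTwoBasis {K : Type*} [Field K] [CharP K 2] {ι : Type*} (t : ι → K) : Prop :=
  LinearIndependent (frobenius K 2).fieldRange (fun s : Finset ι => ∏ i ∈ s, t i) ∧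
    Submodule.span (frobenius K 2).fieldRange
      (Set.range fun s : Finset ι => ∏ i ∈ s, t i) = ⊤

section Local

variable {F : Type*} [Field F] [Valued F ℤᵐ⁰]

instance residueField_charP [CharP F 2] : CharP 𝓀[F] 2 := by
  have h₁ : CharP 𝒪[F] 2 :=
    (RingHom.charP_iff 𝒪[F].subtype Subtype.val_injective 2).2 inferInstance
  have h₂ : (2 : 𝓀[F]) = 0 := by
    rw [← map_ofNat (IsLocalRing.residue 𝒪[F]) 2, CharTwo.two_eq_zero, map_zero]
  exact CharTwo.of_one_ne_zero_of_two_eq_zero one_ne_zero h₂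

/-- `t` is a lifting of the family `b` of elements of the residue field. -/
def IsLifting {ι : Type*} (b : ι → 𝓀[F]) (t : ι → 𝒪[F]) : Prop :=
  ∀ i, IsLocalRing.residue 𝒪[F] (t i) = b i

/-- `α` is the Teichmüller lifting attached to the lifting `t` of the 2-basis `b` of the residue
field: it is a section of the residue map that sends each `bᵢ` to `tᵢ`. -/
structure IsTeichmullerLifting {ι : Type*} (b : ι → 𝓀[F]) (t : ι → 𝒪[F])
    (α : 𝓀[F] →+* 𝒪[F]) : Prop where
  residue_apply : ∀ a, IsLocalRing.residue 𝒪[F] (α a) = a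
  apply_basis : ∀ i, α (b i) = t i

/-- A section of the residue map, as a homomorphism of fields from the residue field to `F`. -/
abbrev toField (α : 𝓀[F] →+* 𝒪[F]) : 𝓀[F] →+* F := 𝒪[F].subtype.comp α

/-- `W₁(H₂^{m+1}(F)) = coker (α' : H₂^{m+1}(F̄) → H₂^{m+1}(F))`. -/
abbrev W₁ (α : 𝓀[F] →+* 𝒪[F]) (m : ℕ) : Type _ := H F m ⧸ (cohomMap (toField α) m).range

/-- The projection `H₂^{m+1}(F) → W₁(H₂^{m+1}(F))`. -/
abbrev toW₁ (α : 𝓀[F] →+* 𝒪[F]) (m : ℕ) : H F m →+ W₁ α m :=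
  QuotientAddGroup.mk' (cohomMap (toField α) m).range

/-- The ring `R = F̄[π⁻¹] ⊆ F`, where `F̄` is embedded in `F` by `α`. -/
def ringR (α : 𝓀[F] →+* 𝒪[F]) (π : F) : Subring F :=
  (Polynomial.eval₂RingHom (toField α) π⁻¹).range

/-- The family `(tᵢ)` with index set `ι`, extended by `t_∞ = π` to the index set
`ι ∪ {∞}`, where `i < ∞` for all `i ∈ ι`. -/
def extend {ι : Type*} (t : ι → 𝒪[F]) (π : F) : WithTop ι → F :=
  WithTop.recTopCoe π (fun i => (t i : F))

/-- The subgroup `𝓡` of `H₂^{m+1}(F)`, generated by the classes of the forms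
`t^J r² dt_I/t_I` with `r ∈ π⁻¹R`, where `I` and `J` run over the elements of
`⨁_{ι ∪ {∞}} ℤ/2ℤ` such that `I` has exactly `m` nonzero components and `J + I > I`.
An element of `⨁ ℤ/2ℤ` is given by its support, so that the sum is the symmetric difference; the
order is the lexicographic one where the components are compared from right to left, that is, the
colexicographic order of finite sets. In `dt_I/t_I` the factors are in increasing order. -/
def groupR {ι : Type*} [LinearOrder ι] (t : ι → 𝒪[F]) (α : 𝓀[F] →+* 𝒪[F]) (π : F) (m : ℕ) :
    AddSubgroup (H F m) :=
  AddSubgroup.closure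
    {ω | ∃ (I J : Finset (WithTop ι)) (hI : I.card = m) (s : F),
      toColex I < toColex (J ∆ I) ∧ s ∈ ringR α π ∧
      ω = symbol ((∏ j ∈ J, extend t π j) * (π⁻¹ * s) ^ 2)
        (fun k : Fin m => extend t π (I.orderEmbOfFin hI k))}

end Local

end KatoMilne

end

open KatoMilne

/-!
Write `K` for the residue field. A section `α` of the residue map identifies `F` with `K((π))`
(`exists_laurentEquiv`), which drives all three assertions.

*The cokernel.* A class with coefficient in the maximal ideal vanishes, because `z² - z = c` is
solvable by Hensel's lemma. Moreover `a d(1+y)/(1+y) = (a y/(1+y)) dy/y`. Hence an integral symbol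
does not change when its entries are modified by principal units, so `α` and `β` induce the same
map in cohomology (`cohomMap_toField_eq`), and the two cokernels coincide.

*The isomorphism matching the subgroups `𝓡`.* The two identifications with `K((π))` differ by an
automorphism `σ` of `F` with `σ ∘ α = β` and `σ π = π`. It acts on cohomology, carries the image of
`α'` to that of `β'`, and generators of one `𝓡` to generators of the other
(`exists_equiv_W₁_map_groupR`).

*Injectivity.* The 2-basis and `π` give commuting idempotent derivations `Dᵢ = tᵢ ∂/∂tᵢ` of `F` that
do not increase pole orders (`exists_derivation_extend`). Through them a form `ω` has coefficients
`ω_I`, and so has `dω`. Although the family `t` need not be a 2-basis of `F`, these coefficients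
suffice. Suppose that a sum `ω` of forms `t^J r² dt_I/t_I` equals `ω₀ + η + (Φ ξ - ξ)` with `ω₀`
defined over `α(K)` and `η` exact. Projecting to the joint kernel of finitely many `Dᵢ` kills `η`
(`proj_formCoeff_exact`) and `ω`, is compatible with `Φ`, which squares coefficients
(`exists_artinSchreier`), and leaves `ξ_I² = P(ξ_I) + (integral)`. Since squaring doubles pole
orders, `ξ` has integral coefficients. Applying `d` kills `η` and `Φ ξ`, so `dω` has integral
coefficients too. The condition `J + I > I` says that `k = max J` is not in `I`, and then the
`(I ∪ {k}, J)`-component of `dω` is the single term `t^J r²` (`proj_diffCoeff_monomialForm`). As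
`r ∈ π⁻¹ K[π⁻¹]`, a nonzero such term has a pole, so all terms vanish.

The compatibility with `Φ` amounts to the fact that the Cartier operator fixes logarithmic forms
(`proj_sum_perm_dlog`): the projection of a closed one-form onto the constants is cohomologous to it
(`exists_add_proj_eq`), and `Dᵢ e = e + e²` for `e = Dᵢ x / x`. In characteristic two the
determinants that express wedge products are sums over permutations without signs.
-/

open scoped Valued WithZero symmDiff

namespace KatoMilne

/-! ### Power series expansions in a complete discretely valued field -/

section Complete

variable {F : Type*} [Field F] [Valued F ℤᵐ⁰]

theorem val_le_pow_iff_mem (π : 𝒪[F]) (n : ℕ) (x : 𝒪[F]) :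
    x ∈ Ideal.span {π} ^ n ↔ Valued.v (x : F) ≤ Valued.v (π : F) ^ n := by
  rw [Ideal.span_singleton_pow, Ideal.mem_span_singleton,
    Valuation.Integers.dvd_iff_le (Valuation.integer.integers _)]
  rw [map_pow, map_pow]
  rfl

theorem sModEq_pow_iff (π : 𝒪[F]) (n : ℕ) (x y : 𝒪[F]) :
    x ≡ y [SMOD (Ideal.span {π} ^ n • ⊤ : Submodule 𝒪[F] 𝒪[F])] ↔
      Valued.v ((x : F) - y) ≤ Valued.v (π : F) ^ n := by
  rw [SModEq.sub_mem, smul_eq_mul, Ideal.mul_top, val_le_pow_iff_mem]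
  rfl

/-- Completeness for the valuation topology is completeness for the adic topology. -/
theorem isAdicComplete_span [CompleteSpace F] (π : 𝒪[F]) (h0 : π ≠ 0)
    (h1 : Valued.v (π : F) < 1) : IsAdicComplete (Ideal.span {π}) 𝒪[F] where
  haus' x hx := by
    by_contra hne
    have hv : Valued.v (x : F) ≠ 0 := by simpa using hne
    obtain ⟨n, hn⟩ := exists_pow_lt₀ h1 (Units.mk0 _ hv)
    have := (sModEq_pow_iff π n x 0).1 (hx n)
    simp only [ZeroMemClass.coe_zero, sub_zero] at this
    exact absurd hn (not_lt.2 this)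
  prec' f hf := by
    have hf' : ∀ m n, m ≤ n → Valued.v ((f m : F) - f n) ≤ Valued.v (π : F) ^ m :=
      fun m n h => (sModEq_pow_iff π m _ _).1 (hf h)
    have hc : CauchySeq (fun n => (f n : F)) := by
      refine Valued.cauchy_iff.2 ⟨inferInstance, fun γ => ?_⟩
      obtain ⟨N, hN⟩ := exists_pow_lt₀ h1 (Units.mk0
        (MonoidWithZeroHom.ValueGroup₀.embedding γ.1) (by simp))
      refine ⟨_, Filter.image_mem_map (Filter.mem_atTop N), ?_⟩
      rintro _ ⟨i, hi, rfl⟩ _ ⟨j, hj, rfl⟩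
      rw [Valuation.restrict_lt_iff_lt_embedding]
      refine lt_of_le_of_lt ?_ hN
      have : ((f j : F) - f i) = (f N - f i) - (f N - f j) := by ring
      rw [this]
      exact Valuation.map_sub_le _ (hf' N i hi) (hf' N j hj)
    obtain ⟨L, hL⟩ := cauchySeq_tendsto_of_complete hc
    have key : ∀ n, Valued.v ((f n : F) - L) ≤ Valued.v (π : F) ^ n := by
      intro n
      have hπ : Valued.v.restrict ((π : F) ^ n) ≠ 0 := by simpa using fun h => absurd h h0
      have hev : ∀ᶠ k in Filter.atTop, Valued.v.restrict ((f k : F) - L) <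
          Valued.v.restrict ((π : F) ^ n) :=
        hL ((Valued.mem_nhds).2 ⟨Units.mk0 _ hπ, subset_rfl⟩)
      obtain ⟨k, hk, hkn⟩ := (hev.and (Filter.eventually_ge_atTop n)).exists
      rw [Valuation.restrict_lt_iff, map_pow] at hk
      have : ((f n : F) - L) = (f n - f k) + (f k - L) := by ring
      rw [this]
      exact Valuation.map_add_le _ (hf' n k hkn) hk.le
    have hL1 : Valued.v L ≤ 1 := by
      have : L = f 0 - (f 0 - L) := by ring
      rw [this]
      exact Valuation.map_sub_le _ (f 0).2 (by simpa using key 0)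
    exact ⟨⟨L, hL1⟩, fun n => (sModEq_pow_iff π n _ _).2 (key n)⟩

end Complete

section Evaluation

open PowerSeries

variable {K A : Type*} [CommRing K] [CommRing A]

theorem eval₂_trunc_sub_mem (α : K →+* A) (π : A) (n : ℕ) (p : Polynomial K) :
    Ideal.Quotient.mk (Ideal.span {π} ^ n) (Polynomial.eval₂ α π (trunc n (p : K⟦X⟧))) =
      Ideal.Quotient.mk (Ideal.span {π} ^ n) (Polynomial.eval₂ α π p) := by
  have h : (Polynomial.X : Polynomial K) ^ n ∣ trunc n (p : K⟦X⟧) - p := by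
    rw [Polynomial.X_pow_dvd_iff]
    intro d hd
    simp [coeff_trunc, hd]
  obtain ⟨q, hq⟩ := h
  rw [Ideal.Quotient.eq, ← Polynomial.eval₂_sub, hq, Polynomial.eval₂_mul, Polynomial.eval₂_pow,
    Polynomial.eval₂_X]
  exact Ideal.mul_mem_right _ _ (Ideal.pow_mem_pow (Ideal.mem_span_singleton_self π) n)

/-- Evaluation of a power series at `π` modulo `π ^ n`, the coefficients being mapped by `α`. -/
noncomputable def evalMod (α : K →+* A) (π : A) (n : ℕ) : K⟦X⟧ →+* A ⧸ Ideal.span {π} ^ n where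
  toFun f := Ideal.Quotient.mk _ (Polynomial.eval₂ α π (trunc n f))
  map_one' := by
    rw [← Polynomial.coe_one, eval₂_trunc_sub_mem]
    simp
  map_mul' f g := by
    rw [← trunc_trunc_mul_trunc, ← Polynomial.coe_mul, eval₂_trunc_sub_mem,
      Polynomial.eval₂_mul, map_mul]
  map_zero' := by simp
  map_add' f g := by simp [Polynomial.eval₂_add]

theorem factorPow_comp_evalMod {m n : ℕ} (α : K →+* A) (π : A) (hle : m ≤ n) :
    (Ideal.Quotient.factorPow (Ideal.span {π}) hle).comp (evalMod α π n) = evalMod α π m := by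
  ext f
  change Ideal.Quotient.mk _ _ = Ideal.Quotient.mk _ _
  rw [← trunc_trunc_of_le f hle, eval₂_trunc_sub_mem]

variable (α : K →+* A) (π : A) [IsAdicComplete (Ideal.span {π}) A]

/-- The evaluation `∑ aₙ Xⁿ ↦ ∑ α(aₙ) πⁿ` in a `π`-adically complete ring. -/
noncomputable def evalHom : K⟦X⟧ →+* A :=
  IsAdicComplete.liftRingHom (Ideal.span {π}) (evalMod α π)
    (factorPow_comp_evalMod α π)

theorem mk_evalHom (n : ℕ) (f : K⟦X⟧) :
    Ideal.Quotient.mk (Ideal.span {π} ^ n) (evalHom α π f) =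
      Ideal.Quotient.mk _ (Polynomial.eval₂ α π (trunc n f)) :=
  IsAdicComplete.mk_liftRingHom (Ideal.span {π}) (evalMod α π)
    (factorPow_comp_evalMod α π) n f

theorem evalHom_coe (p : Polynomial K) : evalHom α π (p : K⟦X⟧) = Polynomial.eval₂ α π p := by
  refine sub_eq_zero.1 (IsHausdorff.haus (I := Ideal.span {π}) inferInstance _ fun n => ?_)
  rw [SModEq.zero, smul_eq_mul, Ideal.mul_top, ← Ideal.Quotient.eq, mk_evalHom,
    eval₂_trunc_sub_mem]

theorem evalHom_C (a : K) : evalHom α π (C a) = α a := by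
  rw [← Polynomial.coe_C, evalHom_coe, Polynomial.eval₂_C]

theorem evalHom_X : evalHom α π (X : K⟦X⟧) = π := by
  rw [← Polynomial.coe_X, evalHom_coe, Polynomial.eval₂_X]

end Evaluation

section Laurent

open PowerSeries LaurentSeries

variable {F : Type*} [Field F] [Valued F ℤᵐ⁰]

theorem residue_evalHom (α : 𝓀[F] →+* 𝒪[F])
    (hα : ∀ a, IsLocalRing.residue 𝒪[F] (α a) = a) (π : 𝒪[F])
    [IsAdicComplete (Ideal.span {π}) 𝒪[F]] (hπ : π ∈ 𝓂[F]) (f : 𝓀[F]⟦X⟧) :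
    IsLocalRing.residue 𝒪[F] (evalHom α π f) = constantCoeff f := by
  have hr : IsLocalRing.residue 𝒪[F] π = 0 := (IsLocalRing.residue_eq_zero_iff _).2 hπ
  conv_lhs => rw [← sub_add_cancel f (C (constantCoeff f))]
  obtain ⟨g, hg⟩ := X_dvd_iff.2 (show constantCoeff (f - C (constantCoeff f)) = 0 by simp)
  rw [hg, map_add, map_mul, evalHom_X, evalHom_C, map_add, map_mul, hr, hα]
  simp

theorem isUnit_evalHom (α : 𝓀[F] →+* 𝒪[F])
    (hα : ∀ a, IsLocalRing.residue 𝒪[F] (α a) = a) (π : 𝒪[F])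
    [IsAdicComplete (Ideal.span {π}) 𝒪[F]] (hπ : π ∈ 𝓂[F]) (f : 𝓀[F]⟦X⟧)
    (hf : constantCoeff f ≠ 0) : IsUnit (evalHom α π f) := by
  rwa [← IsLocalRing.residue_ne_zero_iff_isUnit, residue_evalHom α hα π hπ]

/-- Injectivity holds since a nonzero series is a power of `X` times a unit, surjectivity by
successive approximation from the residue field. -/
theorem evalHom_bijective (α : 𝓀[F] →+* 𝒪[F])
    (hα : ∀ a, IsLocalRing.residue 𝒪[F] (α a) = a) (π : 𝒪[F]) (h0 : π ≠ 0)
    [IsAdicComplete (Ideal.span {π}) 𝒪[F]] (hπ : 𝓂[F] = Ideal.span {π}) :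
    Function.Bijective (evalHom α π) := by
  have hπm : π ∈ 𝓂[F] := hπ ▸ Ideal.mem_span_singleton_self π
  have hmap : (Ideal.span {(X : 𝓀[F]⟦X⟧)}).map (evalHom α π) = Ideal.span {π} := by
    rw [Ideal.map_span, Set.image_singleton, evalHom_X]
  constructor
  · rw [injective_iff_map_eq_zero]
    intro f hf
    by_contra hne
    rw [← X_pow_order_mul_divXPowOrder (f := f), map_mul, map_pow, evalHom_X, mul_eq_zero] at hf
    rcases hf with hf | hf
    · exact h0 (eq_zero_of_pow_eq_zero hf)
    · refine (isUnit_evalHom α hα π hπm (divXPowOrder f) ?_).ne_zero hf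
      rwa [Ne, constantCoeff_divXPowOrder_eq_zero_iff]
  · have : IsHausdorff ((Ideal.span {(X : 𝓀[F]⟦X⟧)}).map (evalHom α π)) 𝒪[F] := by
      rw [hmap]; infer_instance
    refine surjective_of_mk_map_comp_surjective (I := Ideal.span {(X : 𝓀[F]⟦X⟧)}) _ ?_
    rintro ⟨x⟩
    refine ⟨C (IsLocalRing.residue 𝒪[F] x), ?_⟩
    change Ideal.Quotient.mk _ _ = Ideal.Quotient.mk _ _
    rw [evalHom_C, Ideal.Quotient.eq, hmap, ← hπ]
    refine (IsLocalRing.residue_eq_zero_iff _).1 ?_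
    rw [map_sub, hα, sub_self]


section Uniformizer

variable [(Valued.v : Valuation F ℤᵐ⁰).IsRankOneDiscrete] {π : F}
  (hπ : (Valued.v : Valuation F ℤᵐ⁰).IsUniformizer π)
include hπ

theorem exists_val_eq_zpow {x : F} (hx : x ≠ 0) :
    ∃ n : ℤ, Valued.v x = (Valued.v π : ℤᵐ⁰) ^ n := by
  have hx0 : Valued.v x ≠ 0 := by simpa using hx
  have hmem : Units.mk0 (Valued.v x) hx0 ∈
      MonoidWithZeroHom.valueGroup (.ofClass (Valued.v : Valuation F ℤᵐ⁰)) :=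
    MonoidWithZeroHom.mem_valueGroup _ ⟨x, rfl⟩
  rw [hπ.zpowers_eq_valueGroup, Subgroup.mem_zpowers_iff] at hmem
  obtain ⟨n, hn⟩ := hmem
  refine ⟨n, ?_⟩
  rw [← Units.val_mk0 hx0, ← hn, Units.val_zpow_eq_zpow_val, Units.val_mk0]

theorem maximalIdeal_eq_span (π₀ : 𝒪[F]) (h : (π₀ : F) = π) : 𝓂[F] = Ideal.span {π₀} := by
  ext x
  rw [IsLocalRing.mem_maximalIdeal, mem_nonunits_iff,
    Valuation.Integers.isUnit_iff_valuation_eq_one (Valuation.integer.integers _)]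
  have := val_le_pow_iff_mem π₀ 1 x
  rw [pow_one, pow_one, h] at this
  rw [this]
  have hx1 : Valued.v (x : F) ≤ (1 : ℤᵐ⁰) := x.2
  change ¬ Valued.v (x : F) = 1 ↔ _
  constructor
  · intro hne
    by_cases hx : (x : F) = 0
    · rw [hx, map_zero]; exact zero_le
    obtain ⟨n, hn⟩ := exists_val_eq_zpow hπ hx
    have hn1 : 1 ≤ n := by
      by_contra hlt
      refine hne (le_antisymm hx1 ?_)
      rw [hn]
      exact one_le_zpow_of_nonpos₀ hπ.val_pos hπ.val_lt_one.le (by omega)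
    rw [hn]
    exact (zpow_le_zpow_right_of_le_one₀ hπ.val_pos hπ.val_lt_one.le hn1).trans_eq (zpow_one _)
  · exact fun hle => (hle.trans_lt hπ.val_lt_one).ne

/-- The equicharacteristic structure theorem: a section of the residue map identifies `F` with the
field of Laurent series in `π`, the valuation being the order in `π`. -/
theorem exists_laurentEquiv [CompleteSpace F] (α : 𝓀[F] →+* 𝒪[F])
    (hα : ∀ a, IsLocalRing.residue 𝒪[F] (α a) = a) :
    ∃ Φ : 𝓀[F]⸨X⸩ ≃+* F, (∀ a, Φ (HahnSeries.C a) = α a) ∧ Φ (HahnSeries.single 1 1) = π ∧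
      ∀ (n : ℤ) (f : 𝓀[F]⸨X⸩), Valued.v (Φ f) ≤ (Valued.v π : ℤᵐ⁰) ^ n ↔
        ∀ k < n, f.coeff k = 0 := by
  set π₀ : 𝒪[F] := ⟨π, hπ.val_lt_one.le⟩ with hπ₀
  have h0 : π₀ ≠ 0 := fun h => hπ.ne_zero (congrArg Subtype.val h)
  have := isAdicComplete_span π₀ h0 hπ.val_lt_one
  have hm := maximalIdeal_eq_span hπ π₀ rfl
  let φ : 𝓀[F]⟦X⟧ ≃+* 𝒪[F] := RingEquiv.ofBijective _ (evalHom_bijective α hα π₀ h0 hm)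
  let Φ : 𝓀[F]⸨X⸩ ≃+* F := IsFractionRing.ringEquivOfRingEquiv φ
  have hΦ : ∀ f : 𝓀[F]⟦X⟧, Φ (HahnSeries.ofPowerSeries ℤ _ f) = evalHom α π₀ f := fun f =>
    IsFractionRing.ringEquivOfRingEquiv_algebraMap φ f
  have hX : Φ (HahnSeries.single 1 1) = π := by
    rw [← HahnSeries.ofPowerSeries_X, hΦ, evalHom_X]
  refine ⟨Φ, fun a => ?_, hX, ?_⟩
  · rw [← HahnSeries.ofPowerSeries_C, hΦ, evalHom_C]
  have hint : ∀ f : 𝓀[F]⸨X⸩, Valued.v (Φ f) ≤ (1 : ℤᵐ⁰) ↔ ∀ k < 0, f.coeff k = 0 := by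
    intro f
    constructor
    · intro h
      obtain ⟨g, hg⟩ := φ.surjective ⟨Φ f, h⟩
      have : f = HahnSeries.ofPowerSeries ℤ _ g := by
        apply Φ.injective
        rw [hΦ]
        exact (congrArg Subtype.val hg).symm
      intro k hk
      rw [this, coeff_coe, if_pos hk]
    · intro h
      have : f = HahnSeries.ofPowerSeries ℤ _ (PowerSeries.mk fun n => f.coeff n) := by
        ext k
        rw [coeff_coe]
        split_ifs with hk
        · exact h k hk
        · rw [PowerSeries.coeff_mk, Int.natAbs_of_nonneg (not_lt.1 hk)]
      rw [this, hΦ]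
      exact (evalHom α π₀ _).2
  intro n f
  have hv : Valued.v π ≠ (0 : ℤᵐ⁰) := hπ.val_ne_zero
  have hs : Φ (HahnSeries.single (-n) 1) = π ^ (-n) := by
    rw [← hX, ← map_zpow₀]
    congr 1
    exact RatFunc.single_zpow _
  have := hint (f * HahnSeries.single (-n) 1)
  rw [map_mul, hs, map_mul, map_zpow₀, zpow_neg, ← div_eq_mul_inv,
    div_le_one₀ (zpow_pos (zero_lt_iff.2 hv) n)] at this
  rw [this]
  constructor
  · intro h k hk
    have := h (k - n) (by omega)
    rwa [HahnSeries.coeff_mul_single, mul_one, sub_neg_eq_add, sub_add_cancel] at this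
  · intro h k hk
    rw [HahnSeries.coeff_mul_single, mul_one]
    exact h _ (by omega)

end Uniformizer

end Laurent

/-! ### Logarithmic derivations -/

section TwoBasis

variable {ι : Type*}

theorem prod_mul_prod_eq {M : Type*} [CommMonoid M] [DecidableEq ι] (b : ι → M) (s u : Finset ι) :
    (∏ i ∈ s, b i) * ∏ i ∈ u, b i = (∏ i ∈ s ∩ u, b i) ^ 2 * ∏ i ∈ s ∆ u, b i := by
  have h : s ∆ u = (s ∪ u) \ (s ∩ u) := by
    ext
    simp only [Finset.mem_symmDiff, Finset.mem_sdiff, Finset.mem_union,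
      Finset.mem_inter]
    tauto
  rw [← Finset.prod_union_inter, h, sq, mul_assoc, mul_comm (∏ i ∈ s ∩ u, b i) (∏ i ∈ _ \ _, b i),
    Finset.prod_sdiff (Finset.inter_subset_left.trans Finset.subset_union_left), mul_comm]

/-- A 2-basis gives commuting logarithmic derivations `bᵢ ∂/∂bᵢ`, which are idempotent because
their eigenvalues lie in the prime field. -/
theorem IsTwoBasis.exists_derivation {K : Type*} [Field K] [CharP K 2] [DecidableEq ι]
    {b : ι → K} (hb : IsTwoBasis b) :
    ∃ D : ι → Derivation ℤ K K, (∀ i j, D i (b j) = if i = j then b j else 0) ∧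
      (∀ i j x, D i (D j x) = D j (D i x)) ∧ ∀ i x, D i (D i x) = D i x := by
  let B := Module.Basis.mk hb.1 hb.2.ge
  have hB : ∀ s, B s = ∏ i ∈ s, b i := fun s => by simp [B]
  let L : ι → K →ₗ[(frobenius K 2).fieldRange] K := fun i =>
    B.constr ℕ fun s => if i ∈ s then ∏ j ∈ s, b j else 0
  have hL : ∀ i s, L i (∏ j ∈ s, b j) = if i ∈ s then ∏ j ∈ s, b j else 0 := fun i s => by
    rw [← hB, Module.Basis.constr_basis, hB]
  have hmul : ∀ i x y, L i (x * y) = x * L i y + y * L i x := by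
    intro i
    have : (LinearMap.mul (frobenius K 2).fieldRange K).compr₂ (L i) =
        (LinearMap.mul (frobenius K 2).fieldRange K).compl₂ (L i) +
          ((LinearMap.mul (frobenius K 2).fieldRange K).compl₂ (L i)).flip := by
      refine B.ext fun s => B.ext fun u => ?_
      simp only [LinearMap.compr₂_apply, LinearMap.mul_apply', LinearMap.add_apply,
        LinearMap.compl₂_apply, LinearMap.flip_apply, hB, hL]
      have hsq : ∀ (c x : K), L i (c ^ 2 * x) = c ^ 2 * L i x := fun c x =>
        (L i).map_smul (⟨c ^ 2, c, rfl⟩ : (frobenius K 2).fieldRange) x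
      rw [prod_mul_prod_eq, hsq, hL, mul_ite, mul_zero, ← prod_mul_prod_eq]
      by_cases hs : i ∈ s <;> by_cases hu : i ∈ u <;>
        simp [Finset.mem_symmDiff, hs, hu, mul_comm, CharTwo.add_self_eq_zero]
    exact fun x y => LinearMap.congr_fun₂ this x y
  refine ⟨fun i => Derivation.mk' (L i).toAddMonoidHom.toIntLinearMap (hmul i), ?_, ?_, ?_⟩
  · intro i j
    have := hL i {j}
    simp only [Finset.prod_singleton, Finset.mem_singleton] at this
    exact this
  · intro i j x
    have : L i ∘ₗ L j = L j ∘ₗ L i := B.ext fun s => by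
      simp only [LinearMap.comp_apply, hB, hL]
      split_ifs <;> simp_all
    exact LinearMap.congr_fun this x
  · intro i x
    have : L i ∘ₗ L i = L i := B.ext fun s => by
      simp only [LinearMap.comp_apply, hB, hL]
      split_ifs <;> simp_all
    exact LinearMap.congr_fun this x

end TwoBasis

section Laurent

open LaurentSeries

variable {K : Type*} [Field K]

/-- The additive map of Laurent series that applies `φ n` to the `n`-th coefficient. -/
def coeffwise (φ : ℤ → K →+ K) : K⸨X⸩ →+ K⸨X⸩ where
  toFun f := ⟨fun n => φ n (f.coeff n), f.isPWO_support.mono fun n hn => by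
    intro h; exact hn (by simp [h])⟩
  map_zero' := by ext; simp
  map_add' f g := by ext; simp

theorem coeff_coeffwise (φ : ℤ → K →+ K) (f : K⸨X⸩) (n : ℤ) :
    (coeffwise φ f).coeff n = φ n (f.coeff n) := rfl

theorem coeffwise_mul (φ : ℤ → K →+ K)
    (hφ : ∀ m n a b, φ (m + n) (a * b) = a * φ n b + b * φ m a) (f g : K⸨X⸩) :
    coeffwise φ (f * g) = f * coeffwise φ g + g * coeffwise φ f := by
  have hs : ∀ h : K⸨X⸩, (coeffwise φ h).support ⊆ h.support := fun h n hn h0 =>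
    hn (by rw [coeff_coeffwise, h0, map_zero])
  ext n
  rw [coeff_coeffwise, HahnSeries.coeff_add, mul_comm g, HahnSeries.coeff_mul,
    HahnSeries.coeff_mul_right' g.isPWO_support (hs g),
    HahnSeries.coeff_mul_left' f.isPWO_support (hs f), map_sum, ← Finset.sum_add_distrib]
  refine Finset.sum_congr rfl fun ij hij => ?_
  rw [← (Finset.mem_antidiagonal.1 hij).2.2, hφ, coeff_coeffwise, coeff_coeffwise,
    mul_comm (g.coeff _)]

end Laurent

section LocalField

open LaurentSeries

variable {F : Type*} [Field F] [CharP F 2] [Valued F ℤᵐ⁰]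

/-- The logarithmic derivations attached to the lifted 2-basis together with the uniformizer. -/
theorem exists_derivation_extend [CompleteSpace F]
    [(Valued.v : Valuation F ℤᵐ⁰).IsRankOneDiscrete] {π : F}
    (hπ : (Valued.v : Valuation F ℤᵐ⁰).IsUniformizer π) {ι : Type*} [DecidableEq ι]
    {b : ι → 𝓀[F]} (hb : IsTwoBasis b) {t : ι → 𝒪[F]} {α : 𝓀[F] →+* 𝒪[F]}
    (hα : IsTeichmullerLifting b t α) :
    ∃ D : WithTop ι → Derivation ℤ F F,
      (∀ i j, D i (extend t π j) = if i = j then extend t π j else 0) ∧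
      (∀ i j x, D i (D j x) = D j (D i x)) ∧ (∀ i x, D i (D i x) = D i x) ∧
      ∀ i x, Valued.v (D i x) ≤ (Valued.v x : ℤᵐ⁰) := by
  obtain ⟨Φ, hC, hX, hv⟩ := exists_laurentEquiv hπ α hα.residue_apply
  obtain ⟨d, hd, hcomm, hidem⟩ := hb.exists_derivation
  let φ : WithTop ι → ℤ → 𝓀[F] →+ 𝓀[F] :=
    WithTop.recTopCoe (fun n => AddMonoidHom.mulLeft (n : 𝓀[F]))
      (fun i _ => (d i : 𝓀[F] →ₗ[ℤ] 𝓀[F]).toAddMonoidHom)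
  have φtop : ∀ n a, φ ⊤ n a = n * a := fun _ _ => rfl
  have φcoe : ∀ (i : ι) n a, φ i n a = d i a := fun _ _ _ => rfl
  have hφ : ∀ i m n a b, φ i (m + n) (a * b) = a * φ i n b + b * φ i m a := by
    intro i m n x y
    induction i using WithTop.recTopCoe with
    | top => simp only [φtop]; push_cast; ring
    | coe i => simp only [φcoe, Derivation.leibniz, smul_eq_mul]
  let E : WithTop ι → F →+ F := fun i =>
    (Φ : 𝓀[F]⸨X⸩ →+ F).comp ((coeffwise (φ i)).comp (Φ.symm : F →+ 𝓀[F]⸨X⸩))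
  have hE : ∀ i f, E i (Φ f) = Φ (coeffwise (φ i) f) := fun i f => by simp [E]
  have hsingle : ∀ i n a, coeffwise (φ i) (HahnSeries.single n a) =
      HahnSeries.single n (φ i n a) := by
    intro i n a
    ext k
    rw [coeff_coeffwise]
    by_cases h : k = n
    · subst h; simp
    · simp [HahnSeries.coeff_single_of_ne h]
  refine ⟨fun i => Derivation.mk' (E i).toIntLinearMap ?_, ?_, ?_, ?_, ?_⟩
  · intro x y
    obtain ⟨f, rfl⟩ := Φ.surjective x
    obtain ⟨g, rfl⟩ := Φ.surjective y
    simp only [AddMonoidHom.coe_toIntLinearMap]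
    rw [← map_mul, hE, hE, hE, coeffwise_mul _ (hφ i), map_add, map_mul, map_mul]
    rfl
  · intro i j
    change E i _ = _
    induction j using WithTop.recTopCoe with
    | top =>
      change E i π = if i = ⊤ then π else 0
      rw [← hX, hE, hsingle]
      induction i using WithTop.recTopCoe with
      | top => simp [φtop]
      | coe i =>
        rw [φcoe, Derivation.map_one_eq_zero]
        simp
    | coe j =>
      change E i (t j : F) = if i = j then (t j : F) else 0
      rw [← hα.apply_basis, ← hC, hE, HahnSeries.C_apply, hsingle]
      induction i using WithTop.recTopCoe with
      | top => simp [φtop]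
      | coe i =>
        rw [φcoe, hd]
        simp only [WithTop.coe_inj]
        split_ifs <;> simp
  · intro i j x
    change E i (E j x) = E j (E i x)
    obtain ⟨f, rfl⟩ := Φ.surjective x
    simp only [hE]
    congr 1
    ext n
    simp only [coeff_coeffwise]
    induction i using WithTop.recTopCoe <;> induction j using WithTop.recTopCoe
    · rfl
    · simp [φtop, φcoe]
    · simp [φtop, φcoe]
    · exact hcomm _ _ _
  · intro i x
    change E i (E i x) = E i x
    obtain ⟨f, rfl⟩ := Φ.surjective x
    simp only [hE]
    congr 1
    ext n
    simp only [coeff_coeffwise]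
    induction i using WithTop.recTopCoe with
    | top =>
      rw [φtop, φtop, ← mul_assoc]
      congr 1
      rcases CharTwo.intCast_cases (R := 𝓀[F]) n with h | h <;> simp [h]
    | coe i => exact hidem _ _
  · intro i x
    change Valued.v (E i x) ≤ _
    by_cases hx : x = 0
    · simp [hx]
    obtain ⟨n, hn⟩ := exists_val_eq_zpow hπ hx
    obtain ⟨f, rfl⟩ := Φ.surjective x
    rw [hE, hn, hv]
    intro k hk
    rw [coeff_coeffwise, (hv n f).1 hn.le k hk, map_zero]

end LocalField

/-! ### Closed one-forms and projections onto eigenspaces -/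

section Derivations

variable {F : Type*} [Field F] {κ : Type*}

theorem derivation_prod (d : Derivation ℤ F F) {N : Type*} [DecidableEq N] (T : Finset N)
    (f : N → F) : d (∏ l ∈ T, f l) = ∑ l ∈ T, d (f l) * ∏ k ∈ T.erase l, f k := by
  induction T using Finset.induction_on with
  | empty => simp
  | insert a T ha ih =>
    rw [Finset.prod_insert ha, Derivation.leibniz, ih, Finset.sum_insert ha,
      Finset.erase_insert ha, smul_eq_mul, smul_eq_mul, Finset.mul_sum, add_comm, mul_comm]
    congr 1
    refine Finset.sum_congr rfl fun l hl => ?_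
    rw [Finset.erase_insert_of_ne (fun h : a = l => ha (h ▸ hl)),
      Finset.prod_insert (fun h => ha (Finset.mem_of_mem_erase h))]
    ring

variable [CharP F 2]

theorem derivation_sq (d : Derivation ℤ F F) (x : F) : d (x ^ 2) = 0 := by
  rw [sq, Derivation.leibniz, CharTwo.add_self_eq_zero]

theorem derivation_sq_mul (d : Derivation ℤ F F) (c x : F) : d (c ^ 2 * x) = c ^ 2 * d x := by
  rw [Derivation.leibniz, derivation_sq, smul_zero, add_zero, smul_eq_mul]

variable (D : κ → Derivation ℤ F F)

/-- The coordinates `cⱼ` of a closed one-form: `dᵢ cⱼ = dⱼ cᵢ`. -/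
def IsClosedFamily (c : κ → F) : Prop := ∀ i j, D i (c j) = D j (c i)

section Perm

variable {N : Type*} [Fintype N] [DecidableEq N] (s : N → κ) (p : N) (c : N → κ → F)

/-- A wedge product of closed one-forms is closed. In characteristic two the alternating sum over
permutations has no signs, and the terms cancel in pairs under a transposition. -/
theorem sum_perm_derivation_prod (hc : ∀ l, l ≠ p → IsClosedFamily D (c l)) :
    ∑ σ : Equiv.Perm N, D (s (σ p)) (∏ l ∈ Finset.univ.erase p, c l (s (σ l))) = 0 := by
  simp only [derivation_prod]
  rw [Finset.sum_comm]
  refine Finset.sum_eq_zero fun l hl => ?_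
  have hlp : l ≠ p := Finset.ne_of_mem_erase hl
  refine Finset.sum_involution (fun σ _ => σ * Equiv.swap p l) ?_ ?_ ?_ ?_
  · intro σ _
    have h : ∏ k ∈ (Finset.univ.erase p).erase l, c k (s ((σ * Equiv.swap p l) k)) =
        ∏ k ∈ (Finset.univ.erase p).erase l, c k (s (σ k)) := by
      refine Finset.prod_congr rfl fun k hk => ?_
      have h1 := Finset.ne_of_mem_erase hk
      have h2 := Finset.ne_of_mem_erase (Finset.mem_of_mem_erase hk)
      rw [Equiv.Perm.mul_apply, Equiv.swap_apply_of_ne_of_ne h2 h1]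
    rw [h, Equiv.Perm.mul_apply, Equiv.Perm.mul_apply, Equiv.swap_apply_left,
      Equiv.swap_apply_right, hc l hlp, CharTwo.add_self_eq_zero]
  · intro σ _ _ h
    exact hlp (Equiv.swap_eq_one_iff.1 (mul_eq_left.1 h)).symm
  · intro σ _
    exact Finset.mem_univ _
  · intro σ _
    simp [mul_assoc]

theorem sum_perm_derivation_mul_prod (hc : ∀ l, l ≠ p → IsClosedFamily D (c l)) (η : F) :
    ∑ σ : Equiv.Perm N, D (s (σ p)) (η * ∏ l ∈ Finset.univ.erase p, c l (s (σ l))) =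
      ∑ σ : Equiv.Perm N, D (s (σ p)) η * ∏ l ∈ Finset.univ.erase p, c l (s (σ l)) := by
  simp only [Derivation.leibniz, smul_eq_mul]
  rw [Finset.sum_add_distrib, ← Finset.mul_sum, sum_perm_derivation_prod D s p c hc, mul_zero,
    zero_add]
  exact Finset.sum_congr rfl fun σ _ => mul_comm _ _

end Perm

section Projection

variable [DecidableEq κ]

/-- The projection of `F` onto the simultaneous eigenspace on which `D i`, for `i` in the list `L`,
is `1` if `i ∈ J` and `0` otherwise. -/
noncomputable def proj (J : Finset κ) : List κ → F →+ F
  | [] => AddMonoidHom.id F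
  | i :: L =>
    if i ∈ J then (D i : F →ₗ[ℤ] F).toAddMonoidHom.comp (proj J L)
    else proj J L + (D i : F →ₗ[ℤ] F).toAddMonoidHom.comp (proj J L)

omit [CharP F 2] in
theorem proj_cons (J : Finset κ) (i : κ) (L : List κ) (x : F) :
    proj D J (i :: L) x =
      if i ∈ J then D i (proj D J L x) else proj D J L x + D i (proj D J L x) := by
  rw [proj]; split_ifs <;> rfl

theorem proj_sq_mul (J : Finset κ) (L : List κ) (c x : F) :
    proj D J L (c ^ 2 * x) = c ^ 2 * proj D J L x := by
  induction L with
  | nil => rfl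
  | cons i L ih =>
    rw [proj_cons, proj_cons, ih, derivation_sq_mul]
    split_ifs <;> ring

theorem proj_eq_ite (J J' : Finset κ) (L : List κ) {x : F}
    (hx : ∀ i ∈ L, D i x = if i ∈ J' then x else 0) :
    proj D J L x = if ∀ i ∈ L, (i ∈ J ↔ i ∈ J') then x else 0 := by
  induction L with
  | nil => simp [proj]
  | cons i L ih =>
    rw [proj_cons, ih fun j hj => hx j (List.mem_cons_of_mem _ hj)]
    have h := hx i List.mem_cons_self
    simp only [List.forall_mem_cons]
    by_cases h3 : ∀ j ∈ L, (j ∈ J ↔ j ∈ J')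
    · rw [if_pos h3, h]
      by_cases h1 : i ∈ J <;> by_cases h2 : i ∈ J' <;>
        simp [h1, h2, CharTwo.add_self_eq_zero, eq_true h3]
    · simp only [eq_false h3, and_false, if_false, map_zero, add_zero, ite_self]

variable (hcomm : ∀ i j x, D i (D j x) = D j (D i x))
include hcomm

omit [CharP F 2] in
theorem proj_derivation (J : Finset κ) (L : List κ) (i : κ) (x : F) :
    proj D J L (D i x) = D i (proj D J L x) := by
  induction L with
  | nil => rfl
  | cons j L ih =>
    rw [proj_cons, proj_cons, ih, hcomm j i]
    split_ifs
    · rfl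
    · rw [map_add]

/-- The degree-one part of the Cartier theorem: a closed one-form differs from its projection onto
the constants by an exact form. -/
theorem exists_add_proj_eq (L : List κ) {e : κ → F} (he : IsClosedFamily D e) :
    ∃ η, ∀ i, e i + proj D ∅ L (e i) = D i η := by
  induction L with
  | nil => exact ⟨0, fun i => by simp [proj, CharTwo.add_self_eq_zero]⟩
  | cons j L ih =>
    obtain ⟨η, hη⟩ := ih
    refine ⟨η + proj D ∅ L (e j), fun i => ?_⟩
    rw [proj_cons, if_neg (Finset.notMem_empty j), map_add, ← hη, ← add_assoc,
      ← proj_derivation D hcomm, ← proj_derivation D hcomm, he j i]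

variable (hidem : ∀ i x, D i (D i x) = D i x)
include hidem

theorem proj_empty_derivation {L : List κ} {i : κ} (hi : i ∈ L) (x : F) :
    proj D ∅ L (D i x) = 0 := by
  induction L with
  | nil => simp at hi
  | cons j L ih =>
    rw [proj_cons, if_neg (Finset.notMem_empty j)]
    rcases List.mem_cons.1 hi with rfl | h
    · rw [proj_derivation D hcomm, hidem, CharTwo.add_self_eq_zero]
    · rw [ih h, map_zero, add_zero]

/-- Replacing closed one-forms by cohomologous ones changes a wedge product by an exact form, which
the projection kills. -/
theorem proj_sum_perm_congr {N : Type*} [Fintype N] [DecidableEq N] {L : List κ} {s : N → κ}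
    (hs : ∀ k, s k ∈ L) (c c' : N → κ → F) (hc : ∀ l, IsClosedFamily D (c l))
    (hc' : ∀ l, IsClosedFamily D (c' l)) (h : ∀ l, ∃ η, ∀ i, c l i + c' l i = D i η) :
    proj D ∅ L (∑ σ : Equiv.Perm N, ∏ l, c l (s (σ l))) =
      proj D ∅ L (∑ σ : Equiv.Perm N, ∏ l, c' l (s (σ l))) := by
  suffices H : ∀ T : Finset N, proj D ∅ L (∑ σ : Equiv.Perm N, ∏ l, c l (s (σ l))) =
      proj D ∅ L (∑ σ : Equiv.Perm N, ∏ l, (if l ∈ T then c' l else c l) (s (σ l))) by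
    simpa using H Finset.univ
  intro T
  induction T using Finset.induction_on with
  | empty => simp
  | insert p T hp ih =>
    rw [ih, ← CharTwo.add_eq_zero, ← map_add, ← Finset.sum_add_distrib]
    obtain ⟨η, hη⟩ := h p
    set e : N → κ → F := fun l => if l ∈ T then c' l else c l with he
    have hcl : ∀ l, l ≠ p → IsClosedFamily D (e l) := fun l _ => by
      rw [he]; dsimp only; split_ifs
      · exact hc' l
      · exact hc l
    have key : ∀ σ : Equiv.Perm N, (∏ l, (if l ∈ T then c' l else c l) (s (σ l))) +
        (∏ l, (if l ∈ insert p T then c' l else c l) (s (σ l))) =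
        D (s (σ p)) η * ∏ l ∈ Finset.univ.erase p, e l (s (σ l)) := by
      intro σ
      rw [← Finset.mul_prod_erase _ _ (Finset.mem_univ p),
        ← Finset.mul_prod_erase (a := p) _
          (fun l => (if l ∈ insert p T then c' l else c l) (s (σ l)))
          (Finset.mem_univ p), if_neg hp, if_pos (Finset.mem_insert_self p T), ← hη, add_mul]
      congr 2
      refine Finset.prod_congr rfl fun l hl => ?_
      simp [e, Finset.mem_insert, Finset.ne_of_mem_erase hl]
    rw [Finset.sum_congr rfl fun σ _ => key σ, ← sum_perm_derivation_mul_prod D s p e hcl, map_sum]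
    exact Finset.sum_eq_zero fun σ _ => proj_empty_derivation D hcomm hidem (hs _) _

end Projection

end Derivations

/-! ### Coefficients of differential forms -/

theorem prod_univ_erase_zero {M : Type*} [CommMonoid M] {m : ℕ} (f : Fin (m + 1) → M) :
    ∏ l ∈ Finset.univ.erase 0, f l = ∏ l : Fin m, f l.succ := by
  rw [← Finset.compl_singleton, ← Fin.image_succ_univ, Finset.prod_image]
  exact fun _ _ _ _ h => Fin.succ_injective _ h

section Coefficients

variable {F : Type*} [Field F] {κ : Type*} (D : κ → Derivation ℤ F F)

/-- The coefficient of an `m`-form at `d log t_{s 0} ∧ … ∧ d log t_{s (m-1)}`, when the derivation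
`D i` is `tᵢ ∂/∂tᵢ`. -/
noncomputable def formCoeff {m : ℕ} (s : Fin m → κ) : Form F m →ₗ[F] F :=
  exteriorPower.alternatingMapLinearEquiv
    (Matrix.detRowAlternating.compLinearMap
      (LinearMap.pi fun k => (D (s k)).liftKaehlerDifferential))

/-- The coefficient at `d log t_{s 0} ∧ … ∧ d log t_{s m}` of the differential of an `m`-form. The
order of the factors is immaterial in characteristic two. -/
noncomputable def diffCoeff {m : ℕ} (s : Fin (m + 1) → κ) : Form F m →+ F :=
  ∑ k, (D (s k) : F →ₗ[ℤ] F).toAddMonoidHom.comp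
    (formCoeff D fun l => s (Equiv.swap 0 k l.succ)).toAddMonoidHom

theorem diffCoeff_apply {m : ℕ} (s : Fin (m + 1) → κ) (ω : Form F m) :
    diffCoeff D s ω = ∑ k, D (s k) (formCoeff D (fun l => s (Equiv.swap 0 k l.succ)) ω) := by
  simp [diffCoeff]

theorem isClosedFamily_derivation (hcomm : ∀ i j x, D i (D j x) = D j (D i x)) (x : F) :
    IsClosedFamily D fun i => D i x := fun i j => hcomm i j x

theorem isClosedFamily_dlog (hcomm : ∀ i j x, D i (D j x) = D j (D i x)) (x : F) :
    IsClosedFamily D fun i => x⁻¹ * D i x := by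
  intro i j
  simp only [Derivation.leibniz, Derivation.leibniz_inv, smul_eq_mul, hcomm i j]
  ring

theorem liftKaehlerDifferential_dlog (i : κ) (x : F) :
    (D i).liftKaehlerDifferential (dlog x) = x⁻¹ * D i x := by
  rw [dlog, map_smul, Derivation.liftKaehlerDifferential_comp_D, smul_eq_mul]

variable [CharP F 2]

theorem formCoeff_smul_ιMulti {m : ℕ} (s : Fin m → κ) (a : F) (v : Fin m → Ω[F⁄ℤ]) :
    formCoeff D s (a • exteriorPower.ιMulti F m v) =
      a * ∑ σ : Equiv.Perm (Fin m), ∏ l, (D (s (σ l))).liftKaehlerDifferential (v l) := by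
  rw [map_smul, formCoeff, exteriorPower.alternatingMapLinearEquiv_apply_ιMulti, smul_eq_mul]
  congr 1
  change Matrix.det (Matrix.of fun l k => (D (s k)).liftKaehlerDifferential (v l)) = _
  rw [← Matrix.det_transpose, Matrix.det_apply]
  refine Finset.sum_congr rfl fun σ _ => ?_
  rcases Int.units_eq_one_or (Equiv.Perm.sign σ) with h | h <;> rw [h]
  · rw [one_smul]; rfl
  · rw [Units.neg_smul, one_smul, CharTwo.neg_eq]; rfl

theorem diffCoeff_smul_ιMulti {m : ℕ} (s : Fin (m + 1) → κ) (a : F) (v : Fin m → Ω[F⁄ℤ]) :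
    diffCoeff D s (a • exteriorPower.ιMulti F m v) =
      ∑ σ : Equiv.Perm (Fin (m + 1)),
        D (s (σ 0)) (a * ∏ l : Fin m, (D (s (σ l.succ))).liftKaehlerDifferential (v l)) := by
  rw [diffCoeff_apply, ← Equiv.sum_comp Equiv.Perm.decomposeFin.symm, Fintype.sum_prod_type]
  refine Finset.sum_congr rfl fun k _ => ?_
  rw [formCoeff_smul_ιMulti, Finset.mul_sum, map_sum]
  refine Finset.sum_congr rfl fun σ _ => ?_
  simp only [Equiv.Perm.decomposeFin_symm_apply_zero, Equiv.Perm.decomposeFin_symm_apply_succ]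

theorem formCoeff_logForm {m : ℕ} (s : Fin m → κ) (a : F) (x : Fin m → F) :
    formCoeff D s (logForm a x) =
      a * ∑ σ : Equiv.Perm (Fin m), ∏ l, (x l)⁻¹ * D (s (σ l)) (x l) := by
  simp only [logForm, formCoeff_smul_ιMulti, liftKaehlerDifferential_dlog]

theorem diffCoeff_logForm {m : ℕ} (s : Fin (m + 1) → κ) (a : F) (x : Fin m → F) :
    diffCoeff D s (logForm a x) =
      ∑ σ : Equiv.Perm (Fin (m + 1)),
        D (s (σ 0)) (a * ∏ l : Fin m, (x l)⁻¹ * D (s (σ l.succ)) (x l)) := by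
  simp only [logForm, diffCoeff_smul_ιMulti, liftKaehlerDifferential_dlog]

variable (hcomm : ∀ i j x, D i (D j x) = D j (D i x))

include hcomm in
theorem diffCoeff_exact {m : ℕ} (s : Fin (m + 1) → κ) {ω : Form F m} (hω : ω ∈ exactForms F m) :
    diffCoeff D s ω = 0 := by
  cases m with
  | zero => rw [(AddSubgroup.mem_bot.1 hω : ω = 0), map_zero]
  | succ m =>
    induction hω using AddSubgroup.closure_induction with
    | zero => exact map_zero _
    | add x y _ _ hx hy => rw [map_add, hx, hy, add_zero]
    | neg x _ hx => rw [map_neg, hx, neg_zero]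
    | mem x hx =>
      obtain ⟨a, rfl⟩ := hx
      have := diffCoeff_smul_ιMulti D s 1 fun i => KaehlerDifferential.D ℤ F (a i)
      rw [one_smul] at this
      refine this.trans ?_
      have h := sum_perm_derivation_prod D s 0 (Fin.cons 0 fun l i => D i (a l)) (by
        intro l hl
        obtain ⟨l, rfl⟩ := Fin.exists_succ_eq.2 hl
        exact isClosedFamily_derivation D hcomm _)
      simpa only [prod_univ_erase_zero, Fin.cons_succ, one_mul,
        Derivation.liftKaehlerDifferential_comp_D] using h

include hcomm in
/-- `d (a dx₁/x₁ ∧ … ∧ dxₘ/xₘ) = da ∧ dx₁/x₁ ∧ … ∧ dxₘ/xₘ`. -/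
theorem diffCoeff_logForm_eq {m : ℕ} (s : Fin (m + 1) → κ) (a : F) (x : Fin m → F) :
    diffCoeff D s (logForm a x) =
      ∑ σ : Equiv.Perm (Fin (m + 1)),
        D (s (σ 0)) a * ∏ l : Fin m, (x l)⁻¹ * D (s (σ l.succ)) (x l) := by
  have h := sum_perm_derivation_mul_prod D s 0
    (Fin.cons 0 fun l i => (x l)⁻¹ * D i (x l)) (by
      intro l hl
      obtain ⟨l, rfl⟩ := Fin.exists_succ_eq.2 hl
      exact isClosedFamily_dlog D hcomm _) a
  rw [diffCoeff_logForm]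
  simpa only [prod_univ_erase_zero, Fin.cons_succ] using h

variable [DecidableEq κ] (hidem : ∀ i x, D i (D i x) = D i x)
include hcomm hidem

theorem proj_formCoeff_exact {m : ℕ} {L : List κ} {s : Fin m → κ} (hs : ∀ k, s k ∈ L)
    {ω : Form F m} (hω : ω ∈ exactForms F m) : proj D ∅ L (formCoeff D s ω) = 0 := by
  cases m with
  | zero => rw [(AddSubgroup.mem_bot.1 hω : ω = 0), map_zero, map_zero]
  | succ m =>
    induction hω using AddSubgroup.closure_induction with
    | zero => rw [map_zero, map_zero]
    | add x y _ _ hx hy => rw [map_add, map_add, hx, hy, add_zero]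
    | neg x _ hx => rw [map_neg, map_neg, hx, neg_zero]
    | mem x hx =>
      obtain ⟨a, rfl⟩ := hx
      have h1 := formCoeff_smul_ιMulti D s 1 fun i => KaehlerDifferential.D ℤ F (a i)
      rw [one_smul, one_mul] at h1
      simp only [Derivation.liftKaehlerDifferential_comp_D] at h1
      have h2 := sum_perm_derivation_mul_prod D s 0 (fun l i => D i (a l))
        (fun l _ => isClosedFamily_derivation D hcomm _) (a 0)
      have h3 : ∀ σ : Equiv.Perm (Fin (m + 1)), ∏ l, D (s (σ l)) (a l) =
          D (s (σ 0)) (a 0) * ∏ l ∈ Finset.univ.erase 0, D (s (σ l)) (a l) := fun σ =>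
        (Finset.mul_prod_erase _ _ (Finset.mem_univ _)).symm
      rw [Finset.sum_congr rfl fun σ _ => h3 σ, ← h2] at h1
      refine (congrArg _ h1).trans ?_
      rw [map_sum]
      exact Finset.sum_eq_zero fun σ _ => proj_empty_derivation D hcomm hidem (hs _) _

theorem proj_dlog {L : List κ} {i : κ} (hi : i ∈ L) (x : F) :
    proj D ∅ L (x⁻¹ * D i x) = (x⁻¹ * D i x) ^ 2 := by
  have h : D i (x⁻¹ * D i x) = x⁻¹ * D i x + (x⁻¹ * D i x) ^ 2 := by
    rw [Derivation.leibniz, Derivation.leibniz_inv, hidem, smul_eq_mul, smul_eq_mul, smul_eq_mul,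
      CharTwo.neg_eq]
    ring
  have h0 := proj_empty_derivation D hcomm hidem hi (x⁻¹ * D i x)
  have h1 := proj_sq_mul D ∅ L (x⁻¹ * D i x) 1
  have h2 : proj D ∅ L 1 = 1 := by
    rw [proj_eq_ite D ∅ ∅ L (by simp)]; simp
  rw [mul_one, h2, mul_one] at h1
  rw [h, map_add, h1] at h0
  exact CharTwo.add_eq_zero.1 h0

/-- The Cartier operator fixes logarithmic forms. -/
theorem proj_sum_perm_dlog {m : ℕ} {L : List κ} {s : Fin m → κ} (hs : ∀ k, s k ∈ L)
    (x : Fin m → F) :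
    proj D ∅ L (∑ σ : Equiv.Perm (Fin m), ∏ l, (x l)⁻¹ * D (s (σ l)) (x l)) =
      (∑ σ : Equiv.Perm (Fin m), ∏ l, (x l)⁻¹ * D (s (σ l)) (x l)) ^ 2 := by
  set e : Fin m → κ → F := fun l i => (x l)⁻¹ * D i (x l) with he
  have hcl : ∀ l, IsClosedFamily D (e l) := fun l => isClosedFamily_dlog D hcomm (x l)
  have h := proj_sum_perm_congr D hcomm hidem hs e (fun l i => proj D ∅ L (e l i)) hcl
    (fun l i j => by rw [← proj_derivation D hcomm, ← proj_derivation D hcomm, hcl l i j])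
    (fun l => exists_add_proj_eq D hcomm L (hcl l))
  change proj D ∅ L (∑ σ : Equiv.Perm (Fin m), ∏ l, e l (s (σ l))) =
    (∑ σ : Equiv.Perm (Fin m), ∏ l, e l (s (σ l))) ^ 2
  rw [h, CharTwo.sum_sq]
  have hsq : ∑ σ : Equiv.Perm (Fin m), ∏ l, proj D ∅ L (e l (s (σ l))) =
      ∑ σ : Equiv.Perm (Fin m), (∏ l, e l (s (σ l))) ^ 2 := by
    refine Finset.sum_congr rfl fun σ _ => ?_
    rw [← Finset.prod_pow]
    exact Finset.prod_congr rfl fun l _ => proj_dlog D hcomm hidem (hs _) (x l)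
  rw [hsq, ← CharTwo.sum_sq]
  have h1 := proj_sq_mul D ∅ L (∑ σ : Equiv.Perm (Fin m), ∏ l, e l (s (σ l))) 1
  rw [mul_one] at h1
  rw [h1, proj_eq_ite D ∅ ∅ L (by simp)]; simp

/-- An Artin-Schreier form is `Φ ξ - ξ` modulo exact forms, for a form `ξ`, where `Φ` squares the
coefficients. -/
theorem exists_artinSchreier {m : ℕ} {ω : Form F m} (hω : ω ∈ artinSchreierForms F m) :
    ∃ ξ : Form F m, (∀ s : Fin (m + 1) → κ, diffCoeff D s ω = diffCoeff D s ξ) ∧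
      ∀ (L : List κ) (s : Fin m → κ), (∀ k, s k ∈ L) →
        proj D ∅ L (formCoeff D s ω) = formCoeff D s ξ ^ 2 + proj D ∅ L (formCoeff D s ξ) := by
  induction hω using AddSubgroup.closure_induction with
  | zero => exact ⟨0, by simp⟩
  | add x y _ _ hx hy =>
    obtain ⟨ξ, h1, h2⟩ := hx
    obtain ⟨ξ', h1', h2'⟩ := hy
    refine ⟨ξ + ξ', fun s => by rw [map_add, map_add, h1, h1'], fun L s hs => ?_⟩
    rw [map_add, map_add, map_add, map_add, h2 L s hs, h2' L s hs, CharTwo.add_sq]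
    ring
  | neg x _ hx =>
    obtain ⟨ξ, h1, h2⟩ := hx
    refine ⟨ξ, fun s => by rw [map_neg, h1, CharTwo.neg_eq], fun L s hs => ?_⟩
    rw [map_neg, map_neg, h2 L s hs, CharTwo.neg_eq]
  | mem ω hω =>
    obtain ⟨a, x, -, rfl⟩ := hω
    refine ⟨logForm a x, fun s => ?_, fun L s hs => ?_⟩
    · rw [diffCoeff_logForm_eq D hcomm, diffCoeff_logForm_eq D hcomm]
      simp only [map_sub, derivation_sq, zero_sub, CharTwo.neg_eq]
    · rw [formCoeff_logForm, formCoeff_logForm, sub_mul, map_sub, proj_sq_mul,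
        proj_sum_perm_dlog D hcomm hidem hs x, CharTwo.sub_eq_add, mul_pow]

end Coefficients

/-! ### Generators and functoriality; independence of the section -/

section Generators

variable {K : Type*} [Field K]

theorem smul_logForm {m : ℕ} (c a : K) (x : Fin m → K) :
    c • logForm a x = logForm (c * a) x := by
  rw [logForm, logForm, smul_smul]

theorem logForm_add {m : ℕ} (a b : K) (x : Fin m → K) :
    logForm (a + b) x = logForm a x + logForm b x := add_smul _ _ _

theorem D_eq_smul_dlog (x : K) : KaehlerDifferential.D ℤ K x = x • dlog x := by
  by_cases hx : x = 0
  · rw [hx, map_zero, zero_smul]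
  · rw [dlog, smul_smul, mul_inv_cancel₀ hx, one_smul]

theorem dlog_zero : dlog (0 : K) = 0 := by rw [dlog, map_zero, smul_zero]

theorem dlog_mul {x y : K} (hx : x ≠ 0) (hy : y ≠ 0) : dlog (x * y) = dlog x + dlog y := by
  rw [dlog, Derivation.leibniz, smul_add, smul_smul, smul_smul, dlog, dlog, add_comm]
  congr 2 <;> field_simp

theorem dlog_eq_smul_dlog_sub_one (x : K) : dlog x = (x⁻¹ * (x - 1)) • dlog (x - 1) := by
  rw [mul_smul, ← D_eq_smul_dlog, map_sub, Derivation.map_one_eq_zero, sub_zero, dlog]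

theorem logForm_eq_zero {m : ℕ} (a : K) {x : Fin m → K} {i : Fin m} (hi : x i = 0) :
    logForm a x = 0 := by
  rw [logForm, (exteriorPower.ιMulti K m).map_coord_zero i (by rw [hi, dlog_zero]), smul_zero]

theorem logForm_update_mul {m : ℕ} (a : K) (x : Fin m → K) (i : Fin m) {y z : K} (hy : y ≠ 0)
    (hz : z ≠ 0) : logForm a (Function.update x i (y * z)) =
      logForm a (Function.update x i y) + logForm a (Function.update x i z) := by
  simp only [logForm, Function.apply_update (fun _ => dlog), dlog_mul hy hz,
    AlternatingMap.map_update_add, smul_add]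

theorem logForm_update_eq {m : ℕ} (a : K) (x : Fin m → K) (i : Fin m) (y : K) :
    logForm a (Function.update x i y) =
      logForm (a * (y⁻¹ * (y - 1))) (Function.update x i (y - 1)) := by
  simp only [logForm, Function.apply_update (fun _ => dlog)]
  rw [dlog_eq_smul_dlog_sub_one, AlternatingMap.map_update_smul, smul_smul]

/-- Every form is a sum of forms `a dx₁/x₁ ∧ … ∧ dxₘ/xₘ`. -/
theorem closure_range_logForm (K : Type*) [Field K] (m : ℕ) :
    AddSubgroup.closure (Set.range fun p : K × (Fin m → K) => logForm p.1 p.2) = ⊤ := by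
  have hspan := exteriorPower.ιMulti_span_of_span K m (Ω[K⁄ℤ])
    (KaehlerDifferential.span_range_derivation ℤ K)
  have hsmul : ∀ (c : K) (ω : Form K m),
      ω ∈ AddSubgroup.closure (Set.range fun p : K × (Fin m → K) => logForm p.1 p.2) →
      c • ω ∈ AddSubgroup.closure (Set.range fun p : K × (Fin m → K) => logForm p.1 p.2) := by
    intro c ω hω
    induction hω using AddSubgroup.closure_induction with
    | zero => rw [smul_zero]; exact zero_mem _
    | add x y _ _ hx hy => rw [smul_add]; exact add_mem hx hy
    | neg x _ hx => rw [smul_neg]; exact neg_mem hx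
    | mem x hx =>
      obtain ⟨⟨a, x⟩, rfl⟩ := hx
      exact AddSubgroup.subset_closure ⟨(c * a, x), (smul_logForm c a x).symm⟩
  refine eq_top_iff.2 fun ω _ => ?_
  have hω : ω ∈ Submodule.span K _ := hspan.ge (Submodule.mem_top (x := ω))
  induction hω using Submodule.span_induction with
  | zero => exact zero_mem _
  | add x y _ _ hx hy => exact add_mem (hx trivial) (hy trivial)
  | smul c x _ hx => exact hsmul c x (hx trivial)
  | mem x hx =>
    obtain ⟨v, hv, rfl⟩ := hx
    choose y hy using fun i => hv (Set.mem_range_self i)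
    refine AddSubgroup.subset_closure ⟨(∏ i, y i, y), ?_⟩
    have : v = fun i => y i • dlog (y i) := funext fun i => by rw [← hy i, D_eq_smul_dlog]
    rw [this]
    exact ((exteriorPower.ιMulti K m).toMultilinearMap.map_smul_univ y fun i => dlog (y i)).symm

theorem symbol_add {m : ℕ} (a b : K) (x : Fin m → K) :
    symbol (a + b) x = symbol a x + symbol b x :=
  congrArg QuotientAddGroup.mk (logForm_add a b x)

theorem cohom_hom_ext {m : ℕ} {A : Type*} [AddCommGroup A] {f g : H K m →+ A}
    (h : ∀ a x, f (symbol a x) = g (symbol a x)) : f = g := by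
  refine QuotientAddGroup.addMonoidHom_ext _ (AddMonoidHom.eq_of_eqOn_dense
    (closure_range_logForm K m) ?_)
  rintro _ ⟨p, rfl⟩
  exact h p.1 p.2

theorem cohomMap_comp {L M : Type*} [Field L] [Field M] (f : K →+* L) (g : L →+* M) (m : ℕ) :
    cohomMap (g.comp f) m = (cohomMap g m).comp (cohomMap f m) :=
  cohom_hom_ext fun a x => by
    rw [AddMonoidHom.comp_apply, cohomMap_symbol, cohomMap_symbol, cohomMap_symbol]
    rfl

theorem cohomMap_id (m : ℕ) : cohomMap (RingHom.id K) m = AddMonoidHom.id (H K m) :=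
  cohom_hom_ext fun a x => by rw [cohomMap_symbol]; rfl

/-- A field isomorphism induces an isomorphism of cohomology groups. -/
noncomputable def cohomEquiv {L : Type*} [Field L] (σ : K ≃+* L) (m : ℕ) : H K m ≃+ H L m :=
  AddMonoidHom.toAddEquiv (cohomMap (σ : K →+* L) m) (cohomMap (σ.symm : L →+* K) m)
    (by rw [← cohomMap_comp, RingEquiv.symm_comp, cohomMap_id])
    (by rw [← cohomMap_comp, RingEquiv.comp_symm, cohomMap_id])

theorem cohomEquiv_symbol {L : Type*} [Field L] (σ : K ≃+* L) {m : ℕ} (a : K) (x : Fin m → K) :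
    cohomEquiv σ m (symbol a x) = symbol (σ a) fun i => σ (x i) :=
  cohomMap_symbol _ a x

end Generators

section Independence

variable {F : Type*} [Field F] [Valued F ℤᵐ⁰] [CompleteSpace F]
  [(Valued.v : Valuation F ℤᵐ⁰).IsRankOneDiscrete] {π : F}
  (hπ : (Valued.v : Valuation F ℤᵐ⁰).IsUniformizer π)
include hπ

/-- Hensel's lemma for `z² - z = c`. -/
theorem exists_sq_sub_eq {c : F} (hc : Valued.v c < (1 : ℤᵐ⁰)) : ∃ z : F, z ^ 2 - z = c := by
  set π₀ : 𝒪[F] := ⟨π, hπ.val_lt_one.le⟩ with hπ₀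
  have h0 : π₀ ≠ 0 := fun h => hπ.ne_zero (congrArg Subtype.val h)
  have := isAdicComplete_span π₀ h0 hπ.val_lt_one
  have hm := maximalIdeal_eq_span hπ π₀ rfl
  set c₀ : 𝒪[F] := ⟨c, hc.le⟩ with hc₀
  have hcm : c₀ ∈ Ideal.span {π₀} := by
    rw [← hm, IsLocalRing.mem_maximalIdeal, mem_nonunits_iff,
      Valuation.Integers.isUnit_iff_valuation_eq_one (Valuation.integer.integers _)]
    exact hc.ne
  obtain ⟨z, hz, -⟩ := HenselianRing.is_henselian (I := Ideal.span {π₀})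
    (Polynomial.X ^ 2 - Polynomial.X - Polynomial.C c₀) (by monicity!) 0
    (by simpa using hcm) (by simp)
  refine ⟨z, ?_⟩
  have := congrArg Subtype.val hz
  simp only [Polynomial.eval_sub, Polynomial.eval_pow, Polynomial.eval_X, Polynomial.eval_C] at this
  exact sub_eq_zero.1 this

theorem symbol_eq_zero {m : ℕ} {c : F} (hc : Valued.v c < (1 : ℤᵐ⁰)) (x : Fin m → F) :
    symbol c x = 0 := by
  obtain ⟨z, rfl⟩ := exists_sq_sub_eq hπ hc
  refine (QuotientAddGroup.eq_zero_iff _).2 (AddSubgroup.mem_sup_right ?_)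
  by_cases h : ∀ i, x i ≠ 0
  · exact AddSubgroup.subset_closure ⟨z, x, h, rfl⟩
  · push Not at h
    obtain ⟨i, hi⟩ := h
    rw [logForm_eq_zero _ hi]
    exact zero_mem _

/-- The class of an integral symbol does not change when its entries are multiplied by principal
units, since `a d(1 + y)/(1 + y) = (a y/(1 + y)) dy/y` has a coefficient in the maximal ideal. -/
theorem symbol_mul_eq {m : ℕ} {a : F} (ha : Valued.v a ≤ (1 : ℤᵐ⁰)) (x u : Fin m → F)
    (hu : ∀ i, Valued.v (u i - 1) < (1 : ℤᵐ⁰)) :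
    symbol a (fun i => x i * u i) = symbol a x := by
  suffices h : ∀ T : Finset (Fin m), symbol a (fun i => if i ∈ T then x i * u i else x i) =
      symbol a x by simpa using h Finset.univ
  intro T
  induction T using Finset.induction_on with
  | empty => simp
  | insert p T hp ih =>
    rw [← ih]
    set y : Fin m → F := fun i => if i ∈ T then x i * u i else x i with hy
    have h1 : (fun i => if i ∈ insert p T then x i * u i else x i) =
        Function.update y p (x p * u p) := by
      ext i
      by_cases hi : i = p
      · subst hi; simp
      · simp [hi, hy]
    have hyp : Function.update y p (x p) = y := by
      conv_rhs => rw [← Function.update_eq_self p y]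
      simp [hy, hp]
    rw [h1]
    have hv1 : Valued.v (u p) = (1 : ℤᵐ⁰) := by
      have := Valuation.map_add_eq_of_lt_left Valued.v
        (show Valued.v (u p - 1) < Valued.v (1 : F) by rw [map_one]; exact hu p)
      rwa [add_sub_cancel, map_one] at this
    have hup : u p ≠ 0 := fun h => by rw [h, map_zero] at hv1; exact zero_ne_one hv1
    by_cases hx : x p = 0
    · rw [hx, zero_mul, ← hx, hyp]
    have hz : symbol a (Function.update y p (u p)) = 0 := by
      rw [symbol, logForm_update_eq]
      refine symbol_eq_zero hπ ?_ _
      rw [map_mul, map_mul, map_inv₀, hv1, inv_one, one_mul]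
      exact (mul_le_of_le_one_left zero_le ha).trans_lt (hu p)
    have h2 : symbol a (Function.update y p (x p * u p)) =
        symbol a (Function.update y p (x p)) + symbol a (Function.update y p (u p)) :=
      congrArg QuotientAddGroup.mk (logForm_update_mul a y p hx hup)
    rw [h2, hz, add_zero, hyp]

/-- Two sections of the residue map induce the same map in cohomology. -/
theorem cohomMap_toField_eq {α β : 𝓀[F] →+* 𝒪[F]}
    (hα : ∀ a, IsLocalRing.residue 𝒪[F] (α a) = a)
    (hβ : ∀ a, IsLocalRing.residue 𝒪[F] (β a) = a) (m : ℕ) :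
    cohomMap (toField α) m = cohomMap (toField β) m := by
  have hlt : ∀ x : 𝒪[F], IsLocalRing.residue 𝒪[F] x = 0 → Valued.v (x : F) < (1 : ℤᵐ⁰) := by
    intro x hx
    have := (IsLocalRing.residue_eq_zero_iff x).1 hx
    rw [IsLocalRing.mem_maximalIdeal, mem_nonunits_iff,
      Valuation.Integers.isUnit_iff_valuation_eq_one (Valuation.integer.integers _)] at this
    exact lt_of_le_of_ne x.2 this
  refine cohom_hom_ext fun a x => ?_
  rw [cohomMap_symbol, cohomMap_symbol]
  have h1 : symbol (toField α a) (fun i => toField α (x i)) =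
      symbol (toField β a) (fun i => toField α (x i)) := by
    have h := symbol_add (toField α a - toField β a) (toField β a) fun i => toField α (x i)
    rw [symbol_eq_zero hπ (c := toField α a - toField β a) (hlt (α a - β a)
      (by rw [map_sub, hα, hβ, sub_self])), zero_add,
      sub_add_cancel] at h
    exact h
  rw [h1]
  by_cases hx : ∀ i, x i ≠ 0
  · have h2 : (fun i => toField α (x i)) =
        fun i => toField β (x i) * toField α (x i) * (toField β (x i))⁻¹ := by
      ext i
      rw [mul_right_comm, mul_inv_cancel₀ ((map_ne_zero _).2 (hx i)), one_mul]
    simp only [h2, mul_assoc]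
    refine symbol_mul_eq hπ (β a).2 _ _ fun i => ?_
    refine hlt (α (x i) * β (x i)⁻¹ - 1) ?_ |>.trans_eq' ?_
    · rw [map_sub, map_mul, hα, hβ, map_one, mul_inv_cancel₀ (hx i), sub_self]
    · rw [← map_inv₀]; rfl
  · push Not at hx
    obtain ⟨i, hi⟩ := hx
    rw [symbol, symbol, logForm_eq_zero (i := i), logForm_eq_zero (i := i)] <;> simp [hi]

end Independence

section Automorphism

variable {F : Type*} [Field F] [Valued F ℤᵐ⁰] {π : F}

/-- Two sections of the residue map differ by an automorphism that fixes the uniformizer. -/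
theorem exists_automorphism [CompleteSpace F]
    [(Valued.v : Valuation F ℤᵐ⁰).IsRankOneDiscrete]
    (hπ : (Valued.v : Valuation F ℤᵐ⁰).IsUniformizer π) {α β : 𝓀[F] →+* 𝒪[F]}
    (hα : ∀ a, IsLocalRing.residue 𝒪[F] (α a) = a)
    (hβ : ∀ a, IsLocalRing.residue 𝒪[F] (β a) = a) :
    ∃ σ : F ≃+* F, (∀ a, σ (toField α a) = toField β a) ∧ σ π = π := by
  obtain ⟨Φ, hC, hX, -⟩ := exists_laurentEquiv hπ α hα
  obtain ⟨Ψ, hC', hX', -⟩ := exists_laurentEquiv hπ β hβ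
  refine ⟨Φ.symm.trans Ψ, fun a => ?_, ?_⟩
  · have := hC a
    rw [RingEquiv.trans_apply, show toField α a = Φ (HahnSeries.C a) from this.symm,
      RingEquiv.symm_apply_apply, hC']
    rfl
  · conv_lhs => rw [← hX]
    rw [RingEquiv.trans_apply, RingEquiv.symm_apply_apply, hX']

theorem map_ringR_le (σ : F ≃+* F) {α β : 𝓀[F] →+* 𝒪[F]}
    (hσ : ∀ a, σ (toField α a) = toField β a) (hσπ : σ π = π) {s : F} (hs : s ∈ ringR α π) :
    σ s ∈ ringR β π := by
  obtain ⟨p, rfl⟩ := hs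
  refine ⟨p, ?_⟩
  have h : (σ : F →+* F).comp (toField α) = toField β := RingHom.ext hσ
  rw [Polynomial.coe_eval₂RingHom, Polynomial.coe_eval₂RingHom, ← h]
  have := Polynomial.hom_eval₂ p (toField α) (σ : F →+* F) π⁻¹
  rw [map_inv₀, RingEquiv.coe_toRingHom, hσπ] at this
  exact this.symm

theorem map_groupR_le {ι : Type*} [LinearOrder ι] (σ : F ≃+* F) {b : ι → 𝓀[F]} {t t' : ι → 𝒪[F]}
    {α β : 𝓀[F] →+* 𝒪[F]} (hα : IsTeichmullerLifting b t α) (hβ : IsTeichmullerLifting b t' β)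
    (hσ : ∀ a, σ (toField α a) = toField β a) (hσπ : σ π = π) (m : ℕ) :
    (groupR t α π m).map (cohomEquiv σ m).toAddMonoidHom ≤ groupR t' β π m := by
  have hext : ∀ j, σ (extend t π j) = extend t' π j := by
    intro j
    induction j using WithTop.recTopCoe with
    | top => exact hσπ
    | coe j =>
      have := hσ (b j)
      change σ (α (b j) : F) = (β (b j) : F) at this
      rwa [hα.apply_basis, hβ.apply_basis] at this
  rw [groupR, AddMonoidHom.map_closure, AddSubgroup.closure_le]
  rintro _ ⟨_, ⟨I, J, hI, s, hIJ, hs, rfl⟩, rfl⟩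
  refine AddSubgroup.subset_closure ⟨I, J, hI, σ s, hIJ, map_ringR_le σ hσ hσπ hs, ?_⟩
  refine (cohomEquiv_symbol σ _ _).trans ?_
  simp only [map_mul, map_prod, map_pow, map_inv₀, hσπ, hext]

theorem exists_equiv_W₁_map_groupR [CompleteSpace F]
    [(Valued.v : Valuation F ℤᵐ⁰).IsRankOneDiscrete]
    (hπ : (Valued.v : Valuation F ℤᵐ⁰).IsUniformizer π) {ι : Type*} [LinearOrder ι] {b : ι → 𝓀[F]}
    {t t' : ι → 𝒪[F]} {α β : 𝓀[F] →+* 𝒪[F]} (hα : IsTeichmullerLifting b t α)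
    (hβ : IsTeichmullerLifting b t' β) (m : ℕ) : ∃ θ : W₁ α m ≃+ W₁ β m,
      ((groupR t α π m).map (toW₁ α m)).map θ.toAddMonoidHom =
        (groupR t' β π m).map (toW₁ β m) := by
  obtain ⟨σ, hσ, hσπ⟩ := exists_automorphism hπ hα.residue_apply hβ.residue_apply
  have hσ' : ∀ a, σ.symm (toField β a) = toField α a := fun a => by
    rw [← hσ, RingEquiv.symm_apply_apply]
  have hσπ' : σ.symm π = π := by conv_lhs => rw [← hσπ, RingEquiv.symm_apply_apply]
  have hcomp : (cohomMap (σ : F →+* F) m).comp (cohomMap (toField α) m) =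
      cohomMap (toField β) m := by
    rw [← cohomMap_comp]
    congr 1
    exact RingHom.ext hσ
  have hrange : (cohomMap (toField α) m).range.map (cohomEquiv σ m : H F m →+ H F m) =
      (cohomMap (toField β) m).range := by
    rw [← hcomp, AddMonoidHom.range_comp]
    rfl
  have hR : (groupR t α π m).map (cohomEquiv σ m).toAddMonoidHom = groupR t' β π m := by
    refine le_antisymm (map_groupR_le σ hα hβ hσ hσπ m) fun x hx => ?_
    refine ⟨(cohomEquiv σ m).symm x, ?_, AddEquiv.apply_symm_apply _ _⟩
    exact map_groupR_le σ.symm hβ hα hσ' hσπ' m ⟨x, hx, rfl⟩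
  refine ⟨QuotientAddGroup.congr _ _ (cohomEquiv σ m) hrange, ?_⟩
  rw [← hR, AddSubgroup.map_map, AddSubgroup.map_map]
  rfl

end Automorphism

/-! ### Independence of the monomial forms -/

/-- The condition `J + I > I` says that `J` is nonempty and that its maximum is not in `I`. -/
theorem max_notMem_of_toColex_lt {κ : Type*} [LinearOrder κ] {I J : Finset κ}
    (h : toColex I < toColex (J ∆ I)) : ∃ k ∈ J, k ∉ I ∧ ∀ j ∈ J, j ≤ k := by
  obtain ⟨a, ha, haI, hmax⟩ := Finset.Colex.toColex_lt_toColex_iff_exists_forall_lt.1 h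
  have haJ : a ∈ J := by
    rcases Finset.mem_symmDiff.1 ha with h | h
    · exact h.1
    · exact absurd h.1 haI
  refine ⟨J.max' ⟨a, haJ⟩, J.max'_mem _, fun hI => ?_, fun j hj => J.le_max' j hj⟩
  refine absurd (J.le_max' a haJ) (not_le.2 (hmax _ hI fun hmem => ?_))
  rcases Finset.mem_symmDiff.1 hmem with h | h
  · exact h.2 hI
  · exact h.2 (J.max'_mem _)

section Core

variable {F : Type*} [Field F] [CharP F 2] {κ : Type*} [LinearOrder κ]

/-- The form `t^J r² dt_I/t_I`, and `0` if `I` does not have exactly `m` elements. -/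
noncomputable def monomialForm (t : κ → F) (m : ℕ) (p : Finset κ × Finset κ) (r : F) : Form F m :=
  if h : p.1.card = m then
    logForm ((∏ j ∈ p.2, t j) * r ^ 2) fun k => t (p.1.orderEmbOfFin h k)
  else 0

theorem monomialForm_add (t : κ → F) (m : ℕ) (p : Finset κ × Finset κ) (r r' : F) :
    monomialForm t m p (r + r') = monomialForm t m p r + monomialForm t m p r' := by
  unfold monomialForm
  split_ifs
  · rw [CharTwo.add_sq, mul_add, logForm_add]
  · rw [add_zero]

theorem monomialForm_zero (t : κ → F) (m : ℕ) (p : Finset κ × Finset κ) :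
    monomialForm t m p 0 = 0 := by
  simpa using monomialForm_add t m p 0 0

variable {D : κ → Derivation ℤ F F} {t : κ → F} (ht : ∀ j, t j ≠ 0)
  (hD : ∀ i j, D i (t j) = if i = j then t j else 0)

include hD in
theorem derivation_monomial (J : Finset κ) (r : F) (i : κ) :
    D i ((∏ j ∈ J, t j) * r ^ 2) = if i ∈ J then (∏ j ∈ J, t j) * r ^ 2 else 0 := by
  have h : D i (∏ j ∈ J, t j) = if i ∈ J then ∏ j ∈ J, t j else 0 := by
    rw [derivation_prod]
    simp only [hD, ite_mul, zero_mul, Finset.sum_ite_eq]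
    split_ifs with h
    · rw [Finset.mul_prod_erase _ _ h]
    · rfl
  rw [mul_comm, derivation_sq_mul, h, mul_ite, mul_zero]

include hD in
theorem proj_monomial {J J' : Finset κ} {L : List κ} (hJ : ∀ j ∈ J, j ∈ L) (hJ' : ∀ j ∈ J', j ∈ L)
    (r : F) : proj D J' L ((∏ j ∈ J, t j) * r ^ 2) =
      if J' = J then (∏ j ∈ J, t j) * r ^ 2 else 0 := by
  rw [proj_eq_ite D J' J L fun i _ => derivation_monomial hD J r i]
  refine if_congr ⟨fun h => ?_, fun h i _ => by rw [h]⟩ rfl rfl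
  ext i
  by_cases hi : i ∈ L
  · exact h i hi
  · exact ⟨fun h' => absurd (hJ' i h') hi, fun h' => absurd (hJ i h') hi⟩

include ht hD in
omit [CharP F 2] in
theorem prod_dlog_eq {N : Type*} [Fintype N] (f g : N → κ) :
    ∏ l, (t (g l))⁻¹ * D (f l) (t (g l)) = if ∀ l, f l = g l then 1 else 0 := by
  have : ∀ l, (t (g l))⁻¹ * D (f l) (t (g l)) = if f l = g l then 1 else 0 := fun l => by
    rw [hD, mul_ite, mul_zero, inv_mul_cancel₀ (ht _)]
  simp only [this]
  rw [Finset.prod_ite_zero]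
  simp

include ht hD in
theorem proj_empty_formCoeff_monomialForm {m : ℕ} {p : Finset κ × Finset κ} {L : List κ}
    (hp : p.2.Nonempty) (hpL : ∀ j ∈ p.2, j ∈ L) (s : Fin m → κ) (r : F) :
    proj D ∅ L (formCoeff D s (monomialForm t m p r)) = 0 := by
  unfold monomialForm
  split_ifs with h
  · rw [formCoeff_logForm, Finset.mul_sum, map_sum]
    refine Finset.sum_eq_zero fun σ _ => ?_
    rw [prod_dlog_eq ht hD, mul_ite, mul_zero, mul_one]
    split_ifs
    · rw [proj_monomial hD hpL (by simp), if_neg hp.ne_empty.symm]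
    · exact map_zero _
  · rw [map_zero, map_zero]

/-- Among the permutations, only the identity matches the enumeration of `{k} ∪ I₀` with that of a
set `I` not containing `k`, and this forces `I = I₀`. -/
theorem perm_match_iff {m : ℕ} {I I₀ : Finset κ} (hI : I.card = m) (hI₀ : I₀.card = m) {k : κ}
    (hk : k ∉ I) (hk₀ : k ∉ I₀) (σ : Equiv.Perm (Fin (m + 1))) :
    (∀ l : Fin m, (Fin.cons k (I₀.orderEmbOfFin hI₀) : Fin (m + 1) → κ) (σ l.succ) =
      I.orderEmbOfFin hI l) ↔ σ = 1 ∧ I = I₀ := by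
  constructor
  · intro h
    have h0 : σ 0 = 0 := by
      by_contra hne
      have hne' : σ.symm 0 ≠ 0 := fun h' => hne (by rw [← h', Equiv.apply_symm_apply, h'])
      obtain ⟨l, hl⟩ := Fin.exists_succ_eq.2 hne'
      have := h l
      rw [hl, Equiv.apply_symm_apply, Fin.cons_zero] at this
      exact hk (this ▸ Finset.orderEmbOfFin_mem I hI l)
    have hsucc : ∀ l : Fin m, ∃ l' : Fin m, l'.succ = σ l.succ := fun l =>
      Fin.exists_succ_eq.2 fun h' => Fin.succ_ne_zero l (σ.injective (h'.trans h0.symm))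
    choose f hf using hsucc
    have hf' : ∀ l, I₀.orderEmbOfFin hI₀ (f l) = I.orderEmbOfFin hI l := fun l => by
      have := h l
      rwa [← hf, Fin.cons_succ] at this
    have hII : I = I₀ := by
      refine Finset.eq_of_subset_of_card_le (fun x hx => ?_) (by rw [hI, hI₀])
      rw [← Finset.mem_coe, ← Finset.range_orderEmbOfFin I hI] at hx
      obtain ⟨l, rfl⟩ := hx
      rw [← hf']
      exact Finset.orderEmbOfFin_mem _ _ _
    subst hII
    refine ⟨Equiv.ext fun x => ?_, rfl⟩
    induction x using Fin.cases with
    | zero => exact h0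
    | succ l => rw [← hf, (I.orderEmbOfFin hI).injective (hf' l)]; rfl
  · rintro ⟨rfl, rfl⟩ l
    rw [Equiv.Perm.one_apply, Fin.cons_succ]

include ht hD in
/-- For `k = max J₀`, the `J₀`-component of the coefficient at `{k} ∪ I₀` of the differential
separates the monomial form of `(I₀, J₀)` from all others. -/
theorem proj_diffCoeff_monomialForm {m : ℕ} {p p₀ : Finset κ × Finset κ} {L : List κ}
    (hp : ∀ k ∈ p.2, (∀ j ∈ p.2, j ≤ k) → k ∉ p.1) (hpL : ∀ j ∈ p.2, j ∈ L)
    (hp₀L : ∀ j ∈ p₀.2, j ∈ L) {k : κ} (hk : k ∈ p₀.2) (hmax : ∀ j ∈ p₀.2, j ≤ k)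
    (hk₀ : k ∉ p₀.1) (hcard : p.1.card = m) (hcard₀ : p₀.1.card = m) (r : F) :
    proj D p₀.2 L (diffCoeff D (Fin.cons k (p₀.1.orderEmbOfFin hcard₀)) (monomialForm t m p r)) =
      if p = p₀ then (∏ j ∈ p₀.2, t j) * r ^ 2 else 0 := by
  obtain ⟨I, J⟩ := p
  obtain ⟨I₀, J₀⟩ := p₀
  dsimp only at *
  rw [monomialForm, dif_pos hcard, diffCoeff_logForm, map_sum]
  simp only [prod_dlog_eq ht hD, mul_ite, mul_zero, mul_one]
  have hterm : ∀ i, proj D J₀ L (D i ((∏ j ∈ J, t j) * r ^ 2)) =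
      if J₀ = J then if i ∈ J then (∏ j ∈ J, t j) * r ^ 2 else 0 else 0 := by
    intro i
    rw [derivation_monomial hD, apply_ite (proj D J₀ L), map_zero, proj_monomial hD hpL hp₀L]
    split_ifs <;> rfl
  by_cases hJ : J₀ = J
  · subst hJ
    simp only [perm_match_iff hcard hcard₀ (hp k hk hmax) hk₀]
    rw [Finset.sum_eq_single 1]
    · simp only [true_and, Prod.mk.injEq, and_true, Equiv.Perm.one_apply, Fin.cons_zero]
      split_ifs
      · rw [hterm, if_pos rfl, if_pos hk]
      · rw [map_zero, map_zero]
    · intro σ _ hσ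
      rw [if_neg fun h => hσ h.1, map_zero, map_zero]
    · exact fun h => absurd (Finset.mem_univ _) h
  · rw [if_neg fun h => hJ (Prod.mk.inj h).2.symm]
    refine Finset.sum_eq_zero fun σ _ => ?_
    split_ifs
    · rw [hterm, if_neg hJ]
    · rw [map_zero, map_zero]

variable {Γ : Type*} [LinearOrderedCommGroupWithZero Γ] {v : Valuation F Γ}
  (hv : ∀ i x, v (D i x) ≤ v x)

include hv

omit [CharP F 2] in
theorem val_proj_le (J : Finset κ) (L : List κ) (x : F) : v (proj D J L x) ≤ v x := by
  induction L with
  | nil => exact le_rfl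
  | cons i L ih =>
    rw [proj_cons]
    split_ifs
    · exact (hv _ _).trans ih
    · exact Valuation.map_add_le _ ih ((hv _ _).trans ih)

omit [CharP F 2] [LinearOrder κ] in
theorem val_diffCoeff_le {m : ℕ} {ω : Form F m} {L : List κ}
    (hω : ∀ s : Fin m → κ, (∀ l, s l ∈ L) → v (formCoeff D s ω) ≤ 1) {s : Fin (m + 1) → κ}
    (hs : ∀ l, s l ∈ L) : v (diffCoeff D s ω) ≤ 1 := by
  rw [diffCoeff_apply]
  exact Valuation.map_sum_le _ fun k _ => (hv _ _).trans (hω _ fun l => hs _)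

variable (hcomm : ∀ i j x, D i (D j x) = D j (D i x)) (hidem : ∀ i x, D i (D i x) = D i x)
include ht hD hcomm hidem

/-- The pole-order argument: if a sum of monomial forms with `J + I > I` is cohomologous to an
integral form, then each summand is integral. -/
theorem val_monomial_le_one {m : ℕ} (r : Finset κ × Finset κ →₀ F)
    (hr : ∀ p ∈ r.support, p.1.card = m ∧ toColex p.1 < toColex (p.2 ∆ p.1)) {ω₀ : Form F m}
    (hω₀ : ∀ s : Fin m → κ, v (formCoeff D s ω₀) ≤ 1)
    (h : r.sum (monomialForm t m) - ω₀ ∈ exactForms F m ⊔ artinSchreierForms F m)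
    (p₀ : Finset κ × Finset κ) : v ((∏ j ∈ p₀.2, t j) * r p₀ ^ 2) ≤ 1 := by
  by_cases hp₀ : p₀ ∈ r.support
  swap
  · rw [Finsupp.notMem_support_iff.1 hp₀]; simp
  set S : Finset κ := r.support.biUnion fun p => p.1 ∪ p.2 with hS
  set L := S.toList with hL
  have hL1 : ∀ p ∈ r.support, ∀ i ∈ p.1, i ∈ L := fun p hp i hi =>
    Finset.mem_toList.2 (Finset.mem_biUnion.2 ⟨p, hp, Finset.mem_union_left _ hi⟩)
  have hL2 : ∀ p ∈ r.support, ∀ i ∈ p.2, i ∈ L := fun p hp i hi =>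
    Finset.mem_toList.2 (Finset.mem_biUnion.2 ⟨p, hp, Finset.mem_union_right _ hi⟩)
  obtain ⟨η, hη, w, hw, hsum⟩ := AddSubgroup.mem_sup.1 h
  have hω : r.sum (monomialForm t m) = ω₀ + η + w := by rw [add_assoc, hsum]; abel
  obtain ⟨ξ, hξ1, hξ2⟩ := exists_artinSchreier D hcomm hidem hw
  -- The constant part of the equation bounds the poles of `ξ`, since `Φ` doubles pole orders.
  have hξ : ∀ s : Fin m → κ, (∀ l, s l ∈ L) → v (formCoeff D s ξ) ≤ 1 := by
    intro s hs
    have h1 : proj D ∅ L (formCoeff D s (r.sum (monomialForm t m))) = 0 := by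
      rw [Finsupp.sum, map_sum, map_sum]
      refine Finset.sum_eq_zero fun p hp => ?_
      obtain ⟨k, hk, -⟩ := max_notMem_of_toColex_lt (hr p hp).2
      exact proj_empty_formCoeff_monomialForm ht hD ⟨k, hk⟩ (hL2 p hp) s _
    rw [hω, map_add, map_add, map_add, map_add, proj_formCoeff_exact D hcomm hidem hs hη, add_zero,
      hξ2 L s hs] at h1
    set c := formCoeff D s ξ
    by_contra! hlt
    have h2 : c ^ 2 = proj D ∅ L (formCoeff D s ω₀) + proj D ∅ L c :=
      CharTwo.add_eq_zero.1 (by rw [← h1]; ring)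
    have h3 : v (c ^ 2) ≤ v c := by
      rw [h2]
      exact Valuation.map_add_le _ ((val_proj_le hv _ _ _).trans ((hω₀ s).trans hlt.le))
        (val_proj_le hv _ _ _)
    rw [map_pow, sq] at h3
    exact absurd h3 (not_le.2 (by
      simpa using mul_lt_mul_of_pos_right hlt (zero_lt_one.trans hlt)))
  -- The coefficient of the differential at `I₀ ∪ {k}` isolates the summand at `p₀ = (I₀, J₀)`.
  obtain ⟨k, hk, hkI, hmax⟩ := max_notMem_of_toColex_lt (hr p₀ hp₀).2
  have hcard₀ := (hr p₀ hp₀).1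
  set s : Fin (m + 1) → κ := Fin.cons k (p₀.1.orderEmbOfFin hcard₀) with hs
  have hsL : ∀ l, s l ∈ L := by
    intro l
    induction l using Fin.cases with
    | zero => exact hL2 p₀ hp₀ k hk
    | succ l => exact hL1 p₀ hp₀ _ (Finset.orderEmbOfFin_mem _ _ _)
  have hval : proj D p₀.2 L (diffCoeff D s (r.sum (monomialForm t m))) =
      (∏ j ∈ p₀.2, t j) * r p₀ ^ 2 := by
    rw [Finsupp.sum, map_sum, map_sum, Finset.sum_eq_single p₀]
    · rw [proj_diffCoeff_monomialForm ht hD (fun k' hk' hmax' => by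
        rwa [le_antisymm (hmax k' hk') (hmax' k hk)]) (hL2 _ hp₀) (hL2 _ hp₀) hk hmax hkI hcard₀
        hcard₀, if_pos rfl]
    · intro p hp hne
      obtain ⟨k₁, hk₁, hk₁I, hmax₁⟩ := max_notMem_of_toColex_lt (hr p hp).2
      rw [proj_diffCoeff_monomialForm ht hD (fun k' hk' hmax' => by
        rwa [le_antisymm (hmax₁ k' hk') (hmax' k₁ hk₁)]) (hL2 _ hp) (hL2 _ hp₀) hk hmax hkI
        (hr p hp).1 hcard₀, if_neg hne]
    · exact fun h => absurd hp₀ h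
  have hdiff : diffCoeff D s (r.sum (monomialForm t m)) = diffCoeff D s ω₀ + diffCoeff D s ξ := by
    rw [hω, map_add, map_add, diffCoeff_exact D hcomm s hη, add_zero, hξ1]
  rw [← hval, hdiff]
  exact (val_proj_le hv _ _ _).trans (Valuation.map_add_le _
    (val_diffCoeff_le hv (fun s _ => hω₀ s) hsL) (val_diffCoeff_le hv hξ hsL))

end Core

/-! ### Injectivity on the wild part -/

section LocalField

variable {F : Type*} [Field F] [Valued F ℤᵐ⁰]

theorem val_toField (α : 𝓀[F] →+* 𝒪[F]) {a : 𝓀[F]} (ha : a ≠ 0) :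
    Valued.v (toField α a) = (1 : ℤᵐ⁰) :=
  (Valuation.Integers.isUnit_iff_valuation_eq_one (Valuation.integer.integers _)).1
    ((isUnit_iff_ne_zero.2 ha).map α)

/-- A nonzero polynomial in `π⁻¹` is not in the maximal ideal: its leading term dominates. -/
theorem one_le_val_of_mem_ringR {π : F} (h0 : π ≠ 0) (h1 : Valued.v π < (1 : ℤᵐ⁰))
    {α : 𝓀[F] →+* 𝒪[F]} {s : F} (hs : s ∈ ringR α π) (hs0 : s ≠ 0) :
    (1 : ℤᵐ⁰) ≤ Valued.v s := by
  obtain ⟨p, rfl⟩ := hs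
  have hp : p ≠ 0 := fun h => hs0 (by rw [h, map_zero])
  have hπ : (1 : ℤᵐ⁰) < Valued.v π⁻¹ := by
    rw [map_inv₀]
    exact (one_lt_inv₀ (zero_lt_iff.2 (by simpa using h0))).2 h1
  have hterm : ∀ i ∈ p.support, Valued.v (toField α (p.coeff i) * π⁻¹ ^ i) =
      (Valued.v π⁻¹ : ℤᵐ⁰) ^ i := fun i hi => by
    rw [map_mul, val_toField α (Polynomial.mem_support_iff.1 hi), one_mul, map_pow]
  have hmem := Polynomial.natDegree_mem_support_of_nonzero hp
  rw [Polynomial.coe_eval₂RingHom, Polynomial.eval₂_eq_sum, Polynomial.sum,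
    Valuation.map_sum_eq_of_lt Valued.v hmem]
  · rw [hterm _ hmem]
    exact one_le_pow₀ hπ.le
  · intro i hi
    rw [Finset.mem_sdiff, Finset.mem_singleton] at hi
    rw [hterm _ hi.1, hterm _ hmem]
    exact pow_lt_pow_right₀ hπ (lt_of_le_of_ne (Polynomial.le_natDegree_of_mem_supp _ hi.1) hi.2)

variable [CharP F 2]

/-- Forms defined over a coefficient field have integral coefficients, since the derivations do not
increase the pole order. -/
theorem val_formCoeff_formMap_le_one {κ : Type*} {D : κ → Derivation ℤ F F}
    (hv : ∀ i x, Valued.v (D i x) ≤ (Valued.v x : ℤᵐ⁰)) (α : 𝓀[F] →+* 𝒪[F]) {m : ℕ}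
    (ω : Form 𝓀[F] m) (s : Fin m → κ) :
    Valued.v (formCoeff D s (formMap (toField α) m ω)) ≤ (1 : ℤᵐ⁰) := by
  have hω : ω ∈ AddSubgroup.closure _ := (closure_range_logForm 𝓀[F] m).ge trivial
  induction hω using AddSubgroup.closure_induction with
  | zero => simp
  | add x y _ _ hx hy =>
    rw [map_add, map_add]
    exact Valuation.map_add_le _ hx hy
  | neg x _ hx => rwa [map_neg, map_neg, Valuation.map_neg]
  | mem x hx =>
    obtain ⟨⟨a, x⟩, rfl⟩ := hx
    dsimp only
    rw [formMap_logForm, formCoeff_logForm, map_mul]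
    refine mul_le_one' (α a).2 (Valuation.map_sum_le _ fun σ _ => ?_)
    rw [map_prod]
    refine Finset.prod_le_one' fun l _ => ?_
    rw [map_mul, map_inv₀]
    exact (mul_le_mul_right (hv _ _) _).trans inv_mul_le_one

/-- Every element of `𝓡` is the class of a sum of monomial forms with distinct `(I, J)`. -/
theorem exists_sum_of_mem_groupR {ι : Type*} [LinearOrder ι] {t : ι → 𝒪[F]} {α : 𝓀[F] →+* 𝒪[F]}
    {π : F} {m : ℕ} {x : H F m} (hx : x ∈ groupR t α π m) :
    ∃ r : Finset (WithTop ι) × Finset (WithTop ι) →₀ F,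
      (∀ p ∈ r.support, p.1.card = m ∧ toColex p.1 < toColex (p.2 ∆ p.1)) ∧
      (∀ p, ∃ s ∈ ringR α π, r p = π⁻¹ * s) ∧
      x = QuotientAddGroup.mk (r.sum (monomialForm (extend t π) m)) := by
  induction hx using AddSubgroup.closure_induction with
  | zero => exact ⟨0, by simp, fun p => ⟨0, zero_mem _, by simp⟩, by simp⟩
  | add x y _ _ hx hy =>
    obtain ⟨r, h1, h2, rfl⟩ := hx
    obtain ⟨r', h1', h2', rfl⟩ := hy
    refine ⟨r + r', fun p hp => ?_, fun p => ?_, ?_⟩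
    · rcases Finset.mem_union.1 (Finsupp.support_add hp) with hp | hp
      · exact h1 p hp
      · exact h1' p hp
    · obtain ⟨s, hs, hrs⟩ := h2 p
      obtain ⟨s', hs', hrs'⟩ := h2' p
      exact ⟨s + s', add_mem hs hs', by rw [Finsupp.add_apply, hrs, hrs', mul_add]⟩
    · rw [Finsupp.sum_add_index' (fun p => monomialForm_zero _ _ p)
        (fun p => monomialForm_add _ _ p)]
      rfl
  | neg x _ hx =>
    obtain ⟨r, h1, h2, rfl⟩ := hx
    refine ⟨r, h1, h2, ?_⟩
    rw [← QuotientAddGroup.mk_neg, ← neg_one_smul F, CharTwo.neg_eq, one_smul]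
  | mem x hx =>
    obtain ⟨I, J, hI, s, hIJ, hs, rfl⟩ := hx
    classical
    refine ⟨Finsupp.single (I, J) (π⁻¹ * s), fun p hp => ?_, fun p => ?_, ?_⟩
    · rw [Finset.mem_singleton.1 (Finsupp.support_single_subset hp)]
      exact ⟨hI, hIJ⟩
    · rw [Finsupp.single_apply]
      split_ifs
      · exact ⟨s, hs, rfl⟩
      · exact ⟨0, zero_mem _, (mul_zero _).symm⟩
    · rw [Finsupp.sum_single_index (monomialForm_zero _ _ _), monomialForm, dif_pos hI]
      rfl

variable [CompleteSpace F] [(Valued.v : Valuation F ℤᵐ⁰).IsRankOneDiscrete] {π : F}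
  (hπ : (Valued.v : Valuation F ℤᵐ⁰).IsUniformizer π)
include hπ

/-- Only the zero class of `𝓡` is unramified. -/
theorem eq_zero_of_mem_groupR_of_mem_range {ι : Type*} [LinearOrder ι] {b : ι → 𝓀[F]}
    (hb : IsTwoBasis b) {t : ι → 𝒪[F]} {α : 𝓀[F] →+* 𝒪[F]} (hα : IsTeichmullerLifting b t α)
    {m : ℕ} {x : H F m} (hx : x ∈ groupR t α π m) (hx' : x ∈ (cohomMap (toField α) m).range) :
    x = 0 := by
  obtain ⟨D, hD, hcomm, hidem, hv⟩ := exists_derivation_extend hπ hb hα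
  obtain ⟨r, hr, hrs, rfl⟩ := exists_sum_of_mem_groupR hx
  obtain ⟨y, hy⟩ := hx'
  obtain ⟨ω₀, rfl⟩ := QuotientAddGroup.mk_surjective y
  have hb0 : ∀ i, b i ≠ 0 := fun i h => by
    have := hb.1.ne_zero ({i} : Finset ι)
    simp [h] at this
  have htv : ∀ i, Valued.v (t i : F) = (1 : ℤᵐ⁰) := fun i => by
    rw [← hα.apply_basis]
    exact val_toField α (hb0 i)
  have ht : ∀ j, extend t π j ≠ 0 := fun j => by
    induction j using WithTop.recTopCoe with
    | top => exact hπ.ne_zero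
    | coe i =>
      intro h
      have := htv i
      rw [show (t i : F) = 0 from h, map_zero] at this
      exact zero_ne_one this
  have hmem : r.sum (monomialForm (extend t π) m) - formMap (toField α) m ω₀ ∈
      exactForms F m ⊔ artinSchreierForms F m := by
    rw [← QuotientAddGroup.eq_iff_sub_mem]
    exact hy.symm
  have hle := val_monomial_le_one ht hD hv hcomm hidem r hr
    (val_formCoeff_formMap_le_one hv α ω₀) hmem
  have hr0 : r = 0 := by
    ext p
    obtain ⟨s, hs, hps⟩ := hrs p
    rw [Finsupp.zero_apply, hps]
    by_contra hne
    have hs0 : s ≠ 0 := fun h => hne (by rw [h, mul_zero])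
    have h1 := one_le_val_of_mem_ringR hπ.ne_zero hπ.val_lt_one hs hs0
    have hprod : Valued.v π ≤ (Valued.v (∏ j ∈ p.2, extend t π j) : ℤᵐ⁰) := by
      have hval : ∀ j, Valued.v (extend t π j) = if j = ⊤ then (Valued.v π : ℤᵐ⁰) else 1 := by
        intro j
        induction j using WithTop.recTopCoe with
        | top => exact (if_pos rfl).symm
        | coe i => exact (htv i).trans (if_neg (WithTop.coe_ne_top)).symm
      rw [map_prod, Finset.prod_congr rfl fun j _ => hval j, Finset.prod_ite_eq']
      split_ifs
      · exact le_rfl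
      · exact hπ.val_lt_one.le
    have h2 := hle p
    rw [hps, map_mul, map_pow, map_mul, map_inv₀] at h2
    have h3 : (Valued.v π : ℤᵐ⁰) * ((Valued.v π)⁻¹ * 1) ^ 2 ≤ 1 :=
      (mul_le_mul' hprod (pow_le_pow_left' (mul_le_mul_right h1 _) 2)).trans h2
    rw [mul_one, sq, ← mul_assoc, mul_inv_cancel₀ hπ.val_ne_zero, one_mul,
      inv_le_one₀ hπ.val_pos] at h3
    exact absurd hπ.val_lt_one (not_lt.2 h3)
  rw [hr0, Finsupp.sum_zero_index]
  rfl

/-- The kernel of the projection is the image of `α'`, which meets `𝓡` trivially. -/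
theorem injOn_toW₁_groupR {ι : Type*} [LinearOrder ι] {b : ι → 𝓀[F]}
    (hb : IsTwoBasis b) {t : ι → 𝒪[F]} {α : 𝓀[F] →+* 𝒪[F]} (hα : IsTeichmullerLifting b t α)
    (m : ℕ) : Set.InjOn (toW₁ α m) (groupR t α π m) := by
  intro x hx y hy hxy
  refine sub_eq_zero.1 (eq_zero_of_mem_groupR_of_mem_range hπ hb hα (sub_mem hx hy) ?_)
  exact (QuotientAddGroup.eq_iff_sub_mem).1 hxy

end LocalField

end KatoMilne
open KatoMilne
theorem corollary2p6 {F : Type*} [Field F] [CharP F 2] [Valued F ℤᵐ⁰]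
    [(Valued.v : Valuation F ℤᵐ⁰).IsRankOneDiscrete] [CompleteSpace F]
    (π : F) (hπ : (Valued.v : Valuation F ℤᵐ⁰).IsUniformizer π)
    {ι : Type*} [LinearOrder ι] (b : ι → 𝓀[F]) (hb : IsTwoBasis b)
    (t t' : ι → 𝒪[F]) (ht : IsLifting b t) (ht' : IsLifting b t')
    (α β : 𝓀[F] →+* 𝒪[F]) (hα : IsTeichmullerLifting b t α) (hβ : IsTeichmullerLifting b t' β)
    (m : ℕ) :
    (∃ e : W₁ α m ≃+ W₁ β m, ∀ x : H F m, e (toW₁ α m x) = toW₁ β m x) ∧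
      (Set.InjOn (toW₁ α m) (groupR t α π m) ∧ Set.InjOn (toW₁ β m) (groupR t' β π m)) ∧
      ∃ θ : W₁ α m ≃+ W₁ β m,
        ((groupR t α π m).map (toW₁ α m)).map θ.toAddMonoidHom =
          (groupR t' β π m).map (toW₁ β m) := by
  refine ⟨?_, ⟨injOn_toW₁_groupR hπ hb hα m, injOn_toW₁_groupR hπ hb hβ m⟩,
    exists_equiv_W₁_map_groupR hπ hα hβ m⟩
  have h := cohomMap_toField_eq hπ hα.residue_apply hβ.residue_apply m
  exact ⟨QuotientAddGroup.quotientAddEquivOfEq (by rw [h]), fun x => rfl⟩
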